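/- Let $\Delta=\{z\in\mathbb C:|z|<1\}$. For $\alpha>-1$ let ${\bf A}^2_\alpha$ be the weighted Bergman space of all analytic functions $\phi$ in $\Delta$ with $$\|\phi\|_\alpha^2:=(\alpha+1)\iint_\Delta|\phi(z)|^2(1-|z|^2)^\alpha\,\frac{dx\,dy}{\pi}<\infty .$$ For $\beta>\alpha>-1$, an analytic function $g$ in $\Delta$ is called a multiplier from ${\bf A}^2_\alpha$ to ${\bf A}^2_\beta$ if $\phi\mapsto g\phi$ is a bounded operator from ${\bf A}^2_\alpha$ to ${\bf A}^2_\beta$, and its multiplier norm is $$\|g\|_{{\bf M}_{\alpha,\beta}}:=\sup_{\phi\in{\bf A}^2_\alpha,\ \phi\ne0}\frac{\|g\phi\|_\beta}{\|\phi\|_\alpha}.$$ For a univalent function $f$ in $\Delta$ with $f(0)=0$, $f'(0)=1$, let $F$ be the analytic branch in $\Delta\times\Delta$, with $F(0,0)=0$, of $$F(z,w)=\log\left(\frac{f(z)-f(w)}{z-w}\cdot\frac{z}{f(z)}\cdot\frac{w}{f(w)}\right)$$ (with the difference quotient read as $f'(z)$ for $z=w$, and $z/f(z)$ read as $1$ at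 $z=0$). For integers $p,q\ge1$ the higher-order Schwarzian derivative of $f$ is $$S_f^{[p,q]}(z):=\frac{\partial^{p+q}F}{\partial z^p\,\partial w^q}(z,z),\qquad z\in\Delta,$$ and $S_f=(f''/f')'-\tfrac12(f''/f')^2$ is the Schwarzian derivative of $f$. Let $\kappa(z)=z/(1-z)^2$ be the Koebe function. **Theorem.** Let $\alpha>-1$. For all integers $p,q\ge1$, the function $S_\kappa^{[p,q]}$ is a multiplier from ${\bf A}^2_\alpha$ to ${\bf A}^2_{\alpha+2p+2q}$, and $$\|S_\kappa^{[p,q]}\|_{{\bf M}_{\alpha,\alpha+2p+2q}}=\sqrt{\mathcal N_{\alpha,p,q}},$$ where $$\mathcal N_{\alpha,p,q}=\frac{[(p+q-1)!]^2}{2^{2p+2q}}\cdot\frac{\Gamma(\alpha+2+2p+2q)}{\Gamma(\alpha+2)}\cdot\left[\frac{\Gamma(\alpha/2+1)}{\Gamma(\alpha/2+1+p+q)}\right]^2 .$$ In the case $p=q=1$ this gives Shimorin's sharp estimate: $S_\kappa$ is a multiplier from ${\bf A}^2_\alpha$ to ${\bf A}^2_{\alpha+4}$, and $$\|S_\kappa\|_{{\bf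 M}_{\alpha,\alpha+4}}^2=\frac{36(\alpha+3)(\alpha+5)}{(\alpha+2)(\alpha+4)} .$$ -/

import Mathlib

/-- The open unit disk of the complex plane, as a set. -/
abbrev disk : Set ℂ := Metric.ball (0 : ℂ) 1

/-- The density of `‖φ‖_α²` before normalization: `|φ(z)|² (1 - |z|²)^α`. -/
noncomputable def bergmanDensity (α : ℝ) (φ : ℂ → ℂ) (z : ℂ) : ℝ :=
  ‖φ z‖ ^ 2 * (1 - ‖z‖ ^ 2) ^ α

/-- Membership in the weighted Bergman space `A²_α`: `φ` is analytic in the disk and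
`∬ |φ|² (1 - |z|²)^α dx dy < ∞`. Only the values of `φ` in the disk matter. -/
def MemBergman (α : ℝ) (φ : ℂ → ℂ) : Prop :=
  DifferentiableOn ℂ φ disk ∧ MeasureTheory.IntegrableOn (bergmanDensity α φ) disk

/-- The norm of `A²_α`: `‖φ‖_α² = (α + 1) ∬ |φ|² (1 - |z|²)^α dx dy / π`. -/
noncomputable def bergmanNorm (α : ℝ) (φ : ℂ → ℂ) : ℝ :=
  √((α + 1) * ((∫ z in disk, bergmanDensity α φ z) / Real.pi))

/-- `g` is a multiplier from `A²_α` to `A²_β`: `g` is analytic in the disk and `φ ↦ g φ` is a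
bounded operator from `A²_α` to `A²_β`. -/
def IsMultiplier (α β : ℝ) (g : ℂ → ℂ) : Prop :=
  DifferentiableOn ℂ g disk ∧
  (∀ φ : ℂ → ℂ, MemBergman α φ → MemBergman β (fun z => g z * φ z)) ∧
  ∃ C : ℝ, ∀ φ : ℂ → ℂ, MemBergman α φ →
    bergmanNorm β (fun z => g z * φ z) ≤ C * bergmanNorm α φ

/-- The multiplier norm: the supremum of `‖g φ‖_β / ‖φ‖_α` over all `φ ∈ A²_α` that do not vanish
identically in the disk. -/
noncomputable def multiplierNorm (α β : ℝ) (g : ℂ → ℂ) : ℝ :=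
  sSup {r : ℝ | ∃ φ : ℂ → ℂ, MemBergman α φ ∧ (∃ z ∈ disk, φ z ≠ 0) ∧
    r = bergmanNorm β (fun z => g z * φ z) / bergmanNorm α φ}

/-- The function `z / f z`, with the value `1 / f'(0)` at the removable singularity `0`
(for `f 0 = 0`). -/
noncomputable def idDiv (f : ℂ → ℂ) (z : ℂ) : ℂ :=
  if z = 0 then (deriv f 0)⁻¹ else z / f z

/-- The function `(f z - f w) / (z - w) * (z / f z) * (w / f w)`, where the difference quotient is
read as `f' z` for `z = w`. -/
noncomputable def grunskyQuotient (f : ℂ → ℂ) (z w : ℂ) : ℂ :=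
  (if z = w then deriv f z else (f z - f w) / (z - w)) * idDiv f z * idDiv f w

/-- `F` is the analytic branch in the bidisk of the logarithm of `grunskyQuotient f`, with
`F(0, 0) = 0`. -/
structure IsGrunskyLog (f : ℂ → ℂ) (F : ℂ → ℂ → ℂ) : Prop where
  analytic : DifferentiableOn ℂ (fun x : ℂ × ℂ => F x.1 x.2) (disk ×ˢ disk)
  exp_eq : ∀ z ∈ disk, ∀ w ∈ disk, Complex.exp (F z w) = grunskyQuotient f z w
  zero : F 0 0 = 0

/-- The analytic branch is determined on the bidisk. -/
theorem IsGrunskyLog.unique {f : ℂ → ℂ} {F G : ℂ → ℂ → ℂ} (hF : IsGrunskyLog f F)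
    (hG : IsGrunskyLog f G) {z w : ℂ} (hz : z ∈ disk) (hw : w ∈ disk) : F z w = G z w := by
  have hconn : IsPreconnected (disk ×ˢ disk : Set (ℂ × ℂ)) :=
    ((convex_ball (0 : ℂ) 1).prod (convex_ball (0 : ℂ) 1)).isPreconnected
  have h0 : (0 : ℂ) ∈ disk := by simp
  let k : ℂ × ℂ → ℝ := fun x => ((F x.1 x.2 - G x.1 x.2) / (2 * Real.pi * Complex.I)).re
  have hint : ∀ x ∈ (disk ×ˢ disk : Set (ℂ × ℂ)), ∃ n : ℤ,
      F x.1 x.2 = G x.1 x.2 + n * (2 * Real.pi * Complex.I) := fun x hx =>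
    Complex.exp_eq_exp_iff_exists_int.1
      ((hF.exp_eq _ hx.1 _ hx.2).trans (hG.exp_eq _ hx.1 _ hx.2).symm)
  have hk : ∀ x ∈ (disk ×ˢ disk : Set (ℂ × ℂ)), ∀ n : ℤ,
      F x.1 x.2 = G x.1 x.2 + n * (2 * Real.pi * Complex.I) → k x = n := by
    intro x _ n hn
    have : (F x.1 x.2 - G x.1 x.2) / (2 * Real.pi * Complex.I) = (n : ℂ) := by
      rw [hn, add_sub_cancel_left, mul_div_cancel_right₀ _ Complex.two_pi_I_ne_zero]
    simp only [k, this, Complex.intCast_re]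
  have hkc : ContinuousOn k (disk ×ˢ disk) :=
    Complex.continuous_re.comp_continuousOn
      ((hF.analytic.continuousOn.sub hG.analytic.continuousOn).div_const _)
  have hdisc : IsDiscrete (Set.range ((↑) : ℤ → ℝ)) :=
    ⟨Int.isClosedEmbedding_coe_real.toHomeomorph.symm.isEmbedding.discreteTopology⟩
  have hconst := hconn.constant_of_mapsTo (T := Set.range ((↑) : ℤ → ℝ)) hdisc
    (f := k) hkc (fun x hx => by
      obtain ⟨n, hn⟩ := hint x hx
      exact ⟨n, (hk x hx n hn).symm⟩)
    (x := (z, w)) (y := (0, 0)) ⟨hz, hw⟩ ⟨h0, h0⟩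
  obtain ⟨n, hn⟩ := hint (z, w) ⟨hz, hw⟩
  have h1 := hk (z, w) ⟨hz, hw⟩ n hn
  have h2 : k (0, 0) = 0 := by simp [k, hF.zero, hG.zero]
  have hn0 : n = 0 := by
    have : (n : ℝ) = 0 := by rw [← h1, hconst, h2]
    exact_mod_cast this
  simpa [hn0] using hn

open Classical in
/-- The analytic branch in the bidisk of
`log ((f z - f w) / (z - w) * (z / f z) * (w / f w))` that vanishes at the origin. It exists for
every univalent `f` in the disk with `f 0 = 0` and `f' 0 = 1`. -/
noncomputable def grunskyLog (f : ℂ → ℂ) : ℂ → ℂ → ℂ :=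
  if h : ∃ F, IsGrunskyLog f F then h.choose else 0

/-- The higher-order Schwarzian derivative: `∂^{p+q} F / ∂z^p ∂w^q` on the diagonal. -/
noncomputable def higherSchwarzian (f : ℂ → ℂ) (p q : ℕ) (z : ℂ) : ℂ :=
  iteratedDeriv p (fun ζ => iteratedDeriv q (fun ω => grunskyLog f ζ ω) z) z

/-- The Schwarzian derivative `(f'' / f')' - (f'' / f')² / 2`. -/
noncomputable def schwarzian (f : ℂ → ℂ) (z : ℂ) : ℂ :=
  deriv (fun ζ => deriv (deriv f) ζ / deriv f ζ) z
    - 1 / 2 * (deriv (deriv f) z / deriv f z) ^ 2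

/-- The Koebe function. -/
noncomputable def koebe (z : ℂ) : ℂ := z / (1 - z) ^ 2

/-- The branch exists for the Koebe function, so that `grunskyLog koebe` is this branch. -/
theorem isGrunskyLog_koebe : IsGrunskyLog koebe (fun z w => Complex.log (1 - z * w)) := by
  have hne : ∀ z ∈ disk, (1 : ℂ) - z ≠ 0 := by
    intro z hz h
    rw [mem_ball_zero_iff, ← sub_eq_zero.1 h] at hz
    simp at hz
  have hslit : ∀ z ∈ disk, ∀ w ∈ disk, 1 - z * w ∈ Complex.slitPlane := by
    intro z hz w hw
    rw [mem_ball_zero_iff] at hz hw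
    have : ‖-(z * w)‖ < 1 := by
      rw [norm_neg, norm_mul]
      nlinarith [norm_nonneg z, norm_nonneg w]
    simpa [sub_eq_add_neg] using Complex.mem_slitPlane_of_norm_lt_one this
  have hd : ∀ z ∈ disk, deriv koebe z = (1 + z) / (1 - z) ^ 3 := by
    intro z hz
    have h1 := hne z hz
    have h := (hasDerivAt_id z).div (((hasDerivAt_id z).const_sub 1).pow 2) (pow_ne_zero 2 h1)
    refine (h.congr_deriv ?_).deriv
    simp only [id, Pi.pow_apply]
    field_simp
    push_cast
    ring
  have hi : ∀ z ∈ disk, idDiv koebe z = (1 - z) ^ 2 := by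
    intro z hz
    unfold idDiv
    split_ifs with h
    · subst h
      rw [hd 0 hz]
      simp
    · have h1 := hne z hz
      unfold koebe
      field_simp
  refine ⟨?_, ?_, by simp⟩
  · intro x hx
    refine DifferentiableAt.differentiableWithinAt ?_
    exact DifferentiableAt.clog (by fun_prop) (hslit _ hx.1 _ hx.2)
  · intro z hz w hw
    rw [Complex.exp_log (Complex.slitPlane_ne_zero (hslit z hz w hw))]
    unfold grunskyQuotient
    rw [hi z hz, hi w hw]
    have h1 := hne z hz
    have h2 := hne w hw
    split_ifs with h
    · subst h
      rw [hd z hz]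
      field_simp
      ring
    · have h3 : z - w ≠ 0 := sub_ne_zero.2 h
      unfold koebe
      field_simp
      ring

/-- The constant `N_{α,p,q}`. -/
noncomputable def koebeConst (α : ℝ) (p q : ℕ) : ℝ :=
  ((p + q - 1).factorial : ℝ) ^ 2 / 2 ^ (2 * p + 2 * q)
    * (Real.Gamma (α + 2 + 2 * p + 2 * q) / Real.Gamma (α + 2))
    * (Real.Gamma (α / 2 + 1) / Real.Gamma (α / 2 + 1 + p + q)) ^ 2

/-!
Squared Bergman norms are weighted `ℓ²` sums of Taylor coefficients. A Hardy-type inequality for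
these weights shows that division by `1 - z ^ 2` is bounded from `A²_a` to `A²_(a + 2)`, with a
constant that is multiplied up over `n` steps into `hardyConst`. For the Koebe function,
`S_κ^[p, q]` is a constant times `koebeNumerator / (1 - z ^ 2) ^ (p + q)`, and since the numerator
has nonnegative coefficients and a definite parity, it is bounded on the disk by its modulus at
`± 1`; this gives the upper bound. It is sharp because the mass of `(1 - z ^ 2) ^ (-s)` in `A²_α`
blows up as `s` increases to `α / 2 + 1`, while away from `± 1` it stays bounded: asymptotically
the numerator acts as its boundary value, and each Hardy step becomes an equality.
-/

open MeasureTheory Filter Topology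
open scoped ENNReal
open Finset.HasAntidiagonal (antidiagonal mem_antidiagonal)

section Parseval

theorem hasSum_sq_norm_of_orthonormal {𝕜 E ι : Type*} [RCLike 𝕜] [NormedAddCommGroup E]
    [InnerProductSpace 𝕜 E] {v : ι → E} (hv : Orthonormal 𝕜 v) {c : ι → 𝕜} {x : E}
    (hx : HasSum (fun i => c i • v i) x) : HasSum (fun i => ‖c i‖ ^ 2) (‖x‖ ^ 2) := by
  refine (hx.norm.pow 2).congr fun s => ?_
  rw [← inner_self_eq_norm_sq (𝕜 := 𝕜), hv.inner_sum, map_sum]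
  simp only [RCLike.conj_mul]
  norm_cast

theorem hasSum_sq_norm_of_hasSum_fourier {T : ℝ} [Fact (0 < T)] {c : ℕ → ℂ}
    {F : C(AddCircle T, ℂ)} (hF : HasSum (fun k : ℕ => c k • fourier (k : ℤ)) F) :
    HasSum (fun k => ‖c k‖ ^ 2) (∫ t, ‖F t‖ ^ 2 ∂AddCircle.haarAddCircle) := by
  have hL : HasSum (fun k : ℕ => c k • fourierLp (T := T) 2 (k : ℤ))
      (F.toLp 2 AddCircle.haarAddCircle ℂ) := by
    simpa [fourierLp] using hF.mapL (ContinuousMap.toLp 2 AddCircle.haarAddCircle ℂ)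
  convert hasSum_sq_norm_of_orthonormal (orthonormal_fourier.comp _ Nat.cast_injective) hL
  rw [← inner_self_eq_norm_sq (𝕜 := ℂ), ContinuousMap.inner_toLp]
  simp only [RCLike.mul_conj]
  norm_cast

theorem lintegral_sq_norm_of_hasSum_exp {c : ℕ → ℂ} (hc : Summable fun k => ‖c k‖) {g : ℝ → ℂ}
    (hg : ∀ θ : ℝ, HasSum (fun k : ℕ => c k * Complex.exp (θ * Complex.I) ^ k) (g θ)) :
    ∫⁻ θ in Set.Ioo (-Real.pi) Real.pi, ENNReal.ofReal (‖g θ‖ ^ 2)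
      = ENNReal.ofReal (2 * Real.pi) * ∑' k, ENNReal.ofReal (‖c k‖ ^ 2) := by
  have : Fact (0 < 2 * Real.pi) := ⟨Real.two_pi_pos⟩
  obtain ⟨F, hF⟩ : Summable fun k : ℕ => c k • fourier (T := 2 * Real.pi) (k : ℤ) :=
    Summable.of_norm (by simpa [norm_smul, fourier_norm] using hc)
  have hFg (θ : ℝ) : F (θ : AddCircle (2 * Real.pi)) = g θ := by
    refine (hF.mapL (ContinuousMap.evalCLM ℂ (θ : AddCircle (2 * Real.pi)))).unique ?_
    convert hg θ using 2 with k
    rw [map_smul, ContinuousMap.evalCLM_apply, fourier_coe_apply, ← Complex.exp_nat_mul,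
      smul_eq_mul]
    congr 2
    push_cast
    field_simp [Real.pi_ne_zero]
  have hgc : Continuous g :=
    (F.continuous.comp (AddCircle.continuous_mk' _)).congr hFg
  have hP := hasSum_sq_norm_of_hasSum_fourier hF
  rw [AddCircle.integral_haarAddCircle,
    ← AddCircle.intervalIntegral_preimage (2 * Real.pi) (-Real.pi)] at hP
  simp only [hFg] at hP
  rw [show -Real.pi + 2 * Real.pi = Real.pi by ring,
    intervalIntegral.integral_of_le (by linarith [Real.pi_pos]), integral_Ioc_eq_integral_Ioo] at hP
  have hint : IntegrableOn (fun θ => ‖g θ‖ ^ 2) (Set.Ioo (-Real.pi) Real.pi) :=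
    (hgc.norm.pow 2).integrableOn_Icc.mono_set Set.Ioo_subset_Icc_self
  rw [← ofReal_integral_eq_lintegral_ofReal hint (.of_forall fun _ => by positivity),
    ← ENNReal.ofReal_tsum_of_nonneg (fun _ => by positivity) hP.summable, hP.tsum_eq,
    ← ENNReal.ofReal_mul (by positivity), smul_eq_mul, mul_inv_cancel_left₀ (by positivity)]

end Parseval

section Taylor

/-- `c` is the sequence of Taylor coefficients at `0` of a function that agrees with `φ` in the
disk. -/
def HasDiskCoeffs (c : ℕ → ℂ) (φ : ℂ → ℂ) : Prop :=
  ∀ z ∈ disk, HasSum (fun k => c k * z ^ k) (φ z)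

/-- The squared norm `∬ |z ^ k|² (1 - |z|²)^a dx dy / π` of a monomial. -/
noncomputable def bergmanWeight (a : ℝ) (k : ℕ) : ℝ :=
  ProbabilityTheory.beta (k + 1) (a + 1)

/-- The square of the norm of `A²_a` without its normalizing factor `(a + 1) / π`, with the value
`∞` for functions outside `A²_a`. -/
noncomputable def bergmanMass (a : ℝ) (φ : ℂ → ℂ) : ℝ≥0∞ :=
  ∫⁻ z in disk, ENNReal.ofReal (bergmanDensity a φ z)

theorem HasDiskCoeffs.summable_norm {c : ℕ → ℂ} {φ : ℂ → ℂ} (h : HasDiskCoeffs c φ) {r : ℝ}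
    (hr : 0 ≤ r) (hr1 : r < 1) : Summable fun k => ‖c k‖ * r ^ k := by
  have hrd : (r : ℂ) ∈ disk := by simpa [abs_of_nonneg hr] using hr1
  simpa [abs_of_nonneg hr] using (h r hrd).summable.norm

theorem HasDiskCoeffs.differentiableOn {c : ℕ → ℂ} {φ : ℂ → ℂ} (h : HasDiskCoeffs c φ) :
    DifferentiableOn ℂ φ disk := by
  intro z hz
  obtain ⟨r, hzr, hr1⟩ := exists_between (mem_ball_zero_iff.1 hz)
  have hd : DifferentiableOn ℂ (fun w => ∑' k, c k * w ^ k) (Metric.ball 0 r) := by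
    refine Complex.differentiableOn_tsum_of_summable_norm
      (h.summable_norm ((norm_nonneg z).trans hzr.le) hr1) (fun k => by fun_prop)
      Metric.isOpen_ball fun k w hw => ?_
    rw [norm_mul, norm_pow]
    gcongr
    exact (mem_ball_zero_iff.1 hw).le
  have heq : Set.EqOn (fun w => ∑' k, c k * w ^ k) φ (Metric.ball 0 r) :=
    fun w hw => (h w (Metric.ball_subset_ball hr1.le hw)).tsum_eq
  have hnhds := Metric.isOpen_ball.mem_nhds (mem_ball_zero_iff.2 hzr)
  exact ((hd.congr heq.symm).differentiableAt hnhds).differentiableWithinAt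

end Taylor

section Weights

theorem bergmanWeight_pos {a : ℝ} (ha : -1 < a) (k : ℕ) : 0 < bergmanWeight a k :=
  ProbabilityTheory.beta_pos (by positivity) (by linarith)

theorem lintegral_pow_mul_rpow {a : ℝ} (ha : -1 < a) (k : ℕ) :
    ∫⁻ x in Set.Ioo (0 : ℝ) 1, ENNReal.ofReal (x ^ k * (1 - x) ^ a)
      = ENNReal.ofReal (bergmanWeight a k) := by
  have hW : 0 < ProbabilityTheory.beta (k + 1) (a + 1) := bergmanWeight_pos ha k
  have h := ProbabilityTheory.lintegral_betaPDF_eq_one (α := k + 1) (β := a + 1) (by positivity)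
    (by linarith)
  simp only [ProbabilityTheory.lintegral_betaPDF, add_sub_cancel_right,
    Real.rpow_natCast, mul_assoc, ENNReal.ofReal_mul (one_div_pos.2 hW).le] at h
  rw [lintegral_const_mul' _ _ ENNReal.ofReal_ne_top, one_div, ENNReal.ofReal_inv_of_pos hW] at h
  exact (ENNReal.eq_inv_of_mul_eq_one_left ((mul_comm _ _).trans h)).trans (inv_inv _)

theorem lintegral_pow_mul_rpow_sq {a : ℝ} (ha : -1 < a) (k : ℕ) :
    ∫⁻ r in Set.Ioo (0 : ℝ) 1, ENNReal.ofReal (2 * r * ((r ^ 2) ^ k * (1 - r ^ 2) ^ a))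
      = ENNReal.ofReal (bergmanWeight a k) := by
  have himg : (fun r : ℝ => r ^ 2) '' Set.Ioo 0 1 = Set.Ioo 0 1 := by
    ext x
    constructor
    · rintro ⟨r, ⟨h0, h1⟩, rfl⟩
      exact ⟨by positivity, by nlinarith⟩
    · rintro ⟨h0, h1⟩
      exact ⟨√x, ⟨Real.sqrt_pos.2 h0, by simpa using Real.sqrt_lt_sqrt h0.le h1⟩,
        Real.sq_sqrt h0.le⟩
  have hmono : MonotoneOn (fun r : ℝ => r ^ 2) (Set.Ioo 0 1) :=
    fun x hx y _ hxy => pow_le_pow_left₀ hx.1.le hxy 2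
  have h := lintegral_image_eq_lintegral_deriv_mul_of_monotoneOn (f' := fun r => 2 * r)
    measurableSet_Ioo (fun x _ => by simpa using (hasDerivAt_pow 2 x).hasDerivWithinAt) hmono
    (fun x => ENNReal.ofReal (x ^ k * (1 - x) ^ a))
  rw [himg, lintegral_pow_mul_rpow ha] at h
  rw [h]
  refine setLIntegral_congr_fun measurableSet_Ioo fun r hr => ?_
  exact ENNReal.ofReal_mul (by linarith [hr.1])

end Weights

section Polar

theorem lintegral_disk_eq_polar {f : ℂ → ℝ≥0∞} (hf : ContinuousOn f disk) :
    ∫⁻ z in disk, f z = ∫⁻ r in Set.Ioo (0 : ℝ) 1, ENNReal.ofReal r *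
      ∫⁻ θ in Set.Ioo (-Real.pi) Real.pi, f (r * Complex.exp (θ * Complex.I)) := by
  have hpolar (p : ℝ × ℝ) :
      Complex.polarCoord.symm p = p.1 * Complex.exp (p.2 * Complex.I) := by
    simp [Complex.polarCoord_symm_apply, Complex.exp_mul_I]
  have hind : Set.EqOn (fun p => ENNReal.ofReal p.1 • disk.indicator f (Complex.polarCoord.symm p))
      ((Set.Iio (1 : ℝ) ×ˢ Set.univ).indicator
        fun p => ENNReal.ofReal p.1 * f (p.1 * Complex.exp (p.2 * Complex.I)))
      polarCoord.target := by
    intro p hp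
    have hp1 : |p.1| = p.1 := abs_of_pos hp.1
    by_cases h : p.1 < 1 <;>
      simp [Set.indicator, hpolar, Complex.norm_exp_ofReal_mul_I, hp1, h]
  have hset : (Set.Iio (1 : ℝ) ×ˢ Set.univ) ∩ polarCoord.target
      = Set.Ioo (0 : ℝ) 1 ×ˢ Set.Ioo (-Real.pi) Real.pi := by
    ext p
    simp only [polarCoord_target, Set.mem_inter_iff, Set.mem_prod, Set.mem_Iio, Set.mem_univ,
      Set.mem_Ioi, Set.mem_Ioo]
    tauto
  have hmeas : AEMeasurable (fun p : ℝ × ℝ =>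
      ENNReal.ofReal p.1 * f (p.1 * Complex.exp (p.2 * Complex.I)))
      (volume.restrict (Set.Ioo (0 : ℝ) 1 ×ˢ Set.Ioo (-Real.pi) Real.pi)) := by
    refine AEMeasurable.mul (by fun_prop) (ContinuousOn.aemeasurable (hf.comp (by fun_prop) ?_)
      (measurableSet_Ioo.prod measurableSet_Ioo))
    rintro p ⟨hp, -⟩
    simpa [Complex.norm_exp_ofReal_mul_I, abs_of_pos hp.1] using hp.2
  rw [← lintegral_indicator measurableSet_ball, ← Complex.lintegral_comp_polarCoord_symm,
    setLIntegral_congr_fun polarCoord.open_target.measurableSet hind,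
    setLIntegral_indicator (measurableSet_Iio.prod .univ), hset, Measure.volume_eq_prod,
    setLIntegral_prod _ hmeas]
  simp only [lintegral_const_mul' _ _ ENNReal.ofReal_ne_top]

theorem one_sub_sq_norm_pos {z : ℂ} (hz : z ∈ disk) : 0 < 1 - ‖z‖ ^ 2 := by
  rw [mem_ball_zero_iff] at hz
  nlinarith [norm_nonneg z]

theorem continuousOn_bergmanDensity (a : ℝ) {φ : ℂ → ℂ} (hφ : ContinuousOn φ disk) :
    ContinuousOn (bergmanDensity a φ) disk :=
  (hφ.norm.pow 2).mul <| ContinuousOn.rpow_const (by fun_prop) fun _ hz =>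
    .inl (one_sub_sq_norm_pos hz).ne'

theorem HasDiskCoeffs.lintegral_circle_bergmanDensity (a : ℝ) {c : ℕ → ℂ} {φ : ℂ → ℂ}
    (h : HasDiskCoeffs c φ) {r : ℝ} (hr : 0 < r) (hr1 : r < 1) :
    ∫⁻ θ in Set.Ioo (-Real.pi) Real.pi,
        ENNReal.ofReal (bergmanDensity a φ (r * Complex.exp (θ * Complex.I)))
      = ENNReal.ofReal (2 * Real.pi) *
        ∑' k, ENNReal.ofReal (‖c k‖ ^ 2 * ((r ^ 2) ^ k * (1 - r ^ 2) ^ a)) := by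
  have hn (θ : ℝ) : ‖(r * Complex.exp (θ * Complex.I) : ℂ)‖ = r := by
    simp [Complex.norm_exp_ofReal_mul_I, abs_of_pos hr]
  have hP := lintegral_sq_norm_of_hasSum_exp (c := fun k => c k * (r : ℂ) ^ k)
    (g := fun θ => φ (r * Complex.exp (θ * Complex.I)))
    (by simpa [abs_of_pos hr] using h.summable_norm hr.le hr1)
    (fun θ => by
      have hθ := h _ (mem_ball_zero_iff.2 ((hn θ).trans_lt hr1))
      simpa only [mul_pow, mul_assoc] using hθ)
  simp only [bergmanDensity, hn, ENNReal.ofReal_mul (sq_nonneg ‖_‖)]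
  rw [lintegral_mul_const' _ _ ENNReal.ofReal_ne_top, hP, mul_assoc, ← ENNReal.tsum_mul_right]
  congr! 3 with k
  have hk : ‖c k * (r : ℂ) ^ k‖ ^ 2 = ‖c k‖ ^ 2 * (r ^ 2) ^ k := by
    simp [abs_of_pos hr, mul_pow, ← pow_mul, mul_comm]
  rw [hk, ENNReal.ofReal_mul (by positivity), ENNReal.ofReal_mul (by positivity), mul_assoc]

theorem HasDiskCoeffs.bergmanMass_eq {a : ℝ} (ha : -1 < a) {c : ℕ → ℂ} {φ : ℂ → ℂ}
    (h : HasDiskCoeffs c φ) :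
    bergmanMass a φ
      = ENNReal.ofReal Real.pi * ∑' k, ENNReal.ofReal (‖c k‖ ^ 2 * bergmanWeight a k) := by
  have hcont : ContinuousOn (fun z => ENNReal.ofReal (bergmanDensity a φ z)) disk :=
    ENNReal.continuous_ofReal.comp_continuousOn
      (continuousOn_bergmanDensity a h.differentiableOn.continuousOn)
  have hcircle : Set.EqOn (fun r : ℝ => ENNReal.ofReal r * ∫⁻ θ in Set.Ioo (-Real.pi) Real.pi,
        ENNReal.ofReal (bergmanDensity a φ (r * Complex.exp (θ * Complex.I))))
      (fun r => ENNReal.ofReal Real.pi * ∑' k, ENNReal.ofReal (‖c k‖ ^ 2) *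
        ENNReal.ofReal (2 * r * ((r ^ 2) ^ k * (1 - r ^ 2) ^ a))) (Set.Ioo 0 1) := by
    intro r hr
    have h0 : 0 ≤ r := hr.1.le
    simp only [h.lintegral_circle_bergmanDensity a hr.1 hr.2, ← ENNReal.tsum_mul_left]
    congr! 2 with k
    simp only [← ENNReal.ofReal_mul, sq_nonneg, Real.pi_pos.le, h0, mul_nonneg, zero_le_two]
    ring_nf
  rw [bergmanMass, lintegral_disk_eq_polar hcont, setLIntegral_congr_fun measurableSet_Ioo hcircle,
    lintegral_const_mul' _ _ ENNReal.ofReal_ne_top, lintegral_tsum fun k => by fun_prop]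
  simp only [lintegral_const_mul' _ _ ENNReal.ofReal_ne_top, lintegral_pow_mul_rpow_sq ha,
    ENNReal.ofReal_mul (sq_nonneg ‖_‖)]

end Polar

section WeightRecursion

theorem beta_add_one_left {u v : ℝ} (hu : 0 < u) (hv : 0 < v) :
    ProbabilityTheory.beta (u + 1) v * (u + v) = u * ProbabilityTheory.beta u v := by
  have huv : 0 < u + v := add_pos hu hv
  have hΓ := (Real.Gamma_pos_of_pos huv).ne'
  rw [ProbabilityTheory.beta, ProbabilityTheory.beta, add_right_comm, Real.Gamma_add_one hu.ne',
    Real.Gamma_add_one huv.ne']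
  field_simp

theorem beta_comm (u v : ℝ) : ProbabilityTheory.beta u v = ProbabilityTheory.beta v u := by
  rw [ProbabilityTheory.beta, ProbabilityTheory.beta, mul_comm, add_comm]

theorem bergmanWeight_succ {a : ℝ} (ha : -1 < a) (k : ℕ) :
    bergmanWeight a (k + 1) * (k + a + 2) = (k + 1) * bergmanWeight a k := by
  have h := beta_add_one_left (u := k + 1) (v := a + 1) (by positivity) (by linarith)
  rw [bergmanWeight, bergmanWeight, ← h]
  push_cast
  ring

theorem bergmanWeight_add_one {a : ℝ} (ha : -1 < a) (k : ℕ) :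
    bergmanWeight (a + 1) k * (k + a + 2) = (a + 1) * bergmanWeight a k := by
  have h := beta_add_one_left (u := a + 1) (v := k + 1) (by linarith) (by positivity)
  rw [bergmanWeight, bergmanWeight, beta_comm _ (a + 1), ← h, beta_comm]
  ring

theorem bergmanWeight_succ_add_add_one {a : ℝ} (ha : -1 < a) (k : ℕ) :
    bergmanWeight a (k + 1) + bergmanWeight (a + 1) k = bergmanWeight a k := by
  have hk : (k + a + 2 : ℝ) ≠ 0 := by have := k.cast_nonneg (α := ℝ); linarith
  refine mul_right_cancel₀ hk ?_
  linear_combination bergmanWeight_succ ha k + bergmanWeight_add_one ha k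

theorem bergmanWeight_add_one_le {a : ℝ} (ha : -1 < a) (k : ℕ) :
    bergmanWeight (a + 1) k ≤ (a + 1) / (a + 2) * bergmanWeight a k := by
  have h := bergmanWeight_add_one ha k
  have hW := (bergmanWeight_pos (a := a + 1) (by linarith) k).le
  rw [div_mul_eq_mul_div, le_div_iff₀ (by linarith), ← h]
  have : (0 : ℝ) ≤ k := k.cast_nonneg
  gcongr
  linarith

theorem bergmanWeight_zero {a : ℝ} (ha : -1 < a) : bergmanWeight a 0 = 1 / (a + 1) := by
  have hΓ := (Real.Gamma_pos_of_pos (show 0 < a + 1 by linarith)).ne'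
  rw [bergmanWeight, ProbabilityTheory.beta, Nat.cast_zero, zero_add, Real.Gamma_one, add_comm 1,
    Real.Gamma_add_one (by linarith : a + 1 ≠ 0)]
  field_simp

end WeightRecursion

section Hardy

theorem sq_norm_div_add_le {E : Type*} [SeminormedAddCommGroup E] {s t : ℝ} (hs : 0 < s)
    (ht : 0 < t) (x y : E) : ‖y‖ ^ 2 / (s + t) ≤ ‖x‖ ^ 2 / s + ‖y - x‖ ^ 2 / t := by
  calc ‖y‖ ^ 2 / (s + t) ≤ (‖x‖ + ‖y - x‖) ^ 2 / (s + t) := by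
        gcongr
        exact norm_le_insert' y x
    _ ≤ _ := by
        simpa using Finset.univ.sq_sum_div_le_sum_sq_div ![‖x‖, ‖y - x‖] (g := ![s, t])
          (by simp [Fin.forall_fin_two, hs, ht])

/-- The sequence of coefficients of `(1 - z²) ∑ b k z ^ k`. -/
def lagTwoDiff {G : Type*} [Sub G] (b : ℕ → G) : ℕ → G
  | 0 => b 0
  | 1 => b 1
  | k + 2 => b (k + 2) - b k

variable {E : Type*} [SeminormedAddCommGroup E]

theorem bergmanWeight_hardy_step {a : ℝ} (ha : -1 < a) (k : ℕ) (x y : E) :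
    bergmanWeight (a + 2) k * ‖x‖ ^ 2 + bergmanWeight (a + 1) (k + 2) * ‖y‖ ^ 2
      ≤ bergmanWeight (a + 1) k * ‖x‖ ^ 2
        + (a + 1) / (a + 2) * (bergmanWeight a (k + 2) * ‖y - x‖ ^ 2) := by
  have hk : (0 : ℝ) < k + 2 := by positivity
  have ha2 : 0 < a + 2 := by linarith
  have hsplit := bergmanWeight_succ_add_add_one (a := a + 1) (by linarith) k
  have hshift := bergmanWeight_succ (a := a + 1) (by linarith) (k + 1)
  have hraise := bergmanWeight_add_one ha (k + 2)
  have hW := (bergmanWeight_pos ha (k + 2)).le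
  have hy := mul_le_mul_of_nonneg_left (sq_norm_div_add_le hk ha2 x y)
    (mul_nonneg (show 0 ≤ a + 1 by linarith) hW)
  push_cast at hshift hraise
  rw [show a + 1 + 1 = a + 2 by ring] at hsplit
  have hysum : (a + 1) * bergmanWeight a (k + 2) * (‖y‖ ^ 2 / (k + 2 + (a + 2)))
      = bergmanWeight (a + 1) (k + 2) * ‖y‖ ^ 2 := by
    rw [← hraise]
    field_simp
    ring
  have hx : (a + 1) * bergmanWeight a (k + 2) * (‖x‖ ^ 2 / (k + 2))
      = bergmanWeight (a + 1) (k + 1) * ‖x‖ ^ 2 := by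
    field_simp
    linear_combination ‖x‖ ^ 2 * (hshift - hraise)
  rw [mul_add, hysum, hx] at hy
  linear_combination hy + ‖x‖ ^ 2 * hsplit

/-- The two boundary terms on the left make the induction work. -/
theorem sum_bergmanWeight_mul_sq_norm_le {a : ℝ} (ha : -1 < a) (b : ℕ → E) (N : ℕ) :
    ∑ k ∈ Finset.range N, bergmanWeight (a + 2) k * ‖b k‖ ^ 2
        + bergmanWeight (a + 1) N * ‖b N‖ ^ 2 + bergmanWeight (a + 1) (N + 1) * ‖b (N + 1)‖ ^ 2
      ≤ (a + 1) / (a + 2) *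
        ∑ k ∈ Finset.range (N + 2), bergmanWeight a k * ‖lagTwoDiff b k‖ ^ 2 := by
  induction N with
  | zero =>
    have h0 := mul_le_mul_of_nonneg_right (bergmanWeight_add_one_le ha 0) (sq_nonneg ‖b 0‖)
    have h1 := mul_le_mul_of_nonneg_right (bergmanWeight_add_one_le ha 1) (sq_nonneg ‖b 1‖)
    simp only [Finset.sum_range_zero, Finset.sum_range_succ, lagTwoDiff, zero_add]
    linarith
  | succ N ih =>
    have hstep := bergmanWeight_hardy_step ha N (b N) (b (N + 2))
    rw [Finset.sum_range_succ, Finset.sum_range_succ _ (N + 2), mul_add,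
      show lagTwoDiff b (N + 2) = b (N + 2) - b N from rfl]
    linarith

theorem HasDiskCoeffs.one_sub_sq_mul {b : ℕ → ℂ} {ψ : ℂ → ℂ} (h : HasDiskCoeffs b ψ) :
    HasDiskCoeffs (lagTwoDiff b) (fun z => (1 - z ^ 2) * ψ z) := by
  intro z hz
  have hshift := ((hasSum_nat_add_iff' 2).2 (h z hz)).sub ((h z hz).mul_left (z ^ 2))
  refine (hasSum_nat_add_iff' 2).1 ?_
  convert hshift using 1
  · funext k
    simp only [lagTwoDiff]
    ring
  · simp only [lagTwoDiff, Finset.sum_range_succ, Finset.sum_range_zero]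
    ring

theorem one_sub_sq_ne_zero {z : ℂ} (hz : z ∈ disk) : 1 - z ^ 2 ≠ 0 := by
  intro h
  have := one_sub_sq_norm_pos hz
  rw [← norm_pow, ← sub_eq_zero.1 h, norm_one, sub_self] at this
  exact this.false

theorem exists_hasDiskCoeffs {φ : ℂ → ℂ} (hφ : DifferentiableOn ℂ φ disk) :
    ∃ c, HasDiskCoeffs c φ := by
  refine ⟨fun k => (k.factorial : ℂ)⁻¹ * iteratedDeriv k φ 0, fun z hz => ?_⟩
  simpa [mul_assoc, mul_comm (z ^ _)] using Complex.hasSum_taylorSeries_on_ball hφ hz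

theorem bergmanMass_congr (a : ℝ) {φ ψ : ℂ → ℂ} (h : Set.EqOn φ ψ disk) :
    bergmanMass a φ = bergmanMass a ψ :=
  setLIntegral_congr_fun measurableSet_ball fun z hz => by simp only [bergmanDensity, h hz]

theorem bergmanMass_le_one_sub_sq_mul {a : ℝ} (ha : -1 < a) {ψ : ℂ → ℂ}
    (hψ : DifferentiableOn ℂ ψ disk) :
    bergmanMass (a + 2) ψ
      ≤ ENNReal.ofReal ((a + 1) / (a + 2)) * bergmanMass a (fun z => (1 - z ^ 2) * ψ z) := by
  obtain ⟨b, hb⟩ := exists_hasDiskCoeffs hψ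
  have hc : 0 ≤ (a + 1) / (a + 2) := div_nonneg (by linarith) (by linarith)
  rw [hb.bergmanMass_eq (by linarith), hb.one_sub_sq_mul.bergmanMass_eq ha, mul_left_comm]
  gcongr
  refine ENNReal.tsum_le_of_sum_range_le fun N => ?_
  refine le_trans ?_ (mul_le_mul_right (ENNReal.sum_le_tsum (Finset.range (N + 2))) _)
  have hW (k : ℕ) := (bergmanWeight_pos ha k).le
  have hW1 (k : ℕ) := (bergmanWeight_pos (a := a + 1) (by linarith) k).le
  have hW2 (k : ℕ) := (bergmanWeight_pos (a := a + 2) (by linarith) k).le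
  rw [← ENNReal.ofReal_sum_of_nonneg fun k _ => mul_nonneg (sq_nonneg _) (hW2 k),
    ← ENNReal.ofReal_sum_of_nonneg fun k _ => mul_nonneg (sq_nonneg _) (hW k),
    ← ENNReal.ofReal_mul hc]
  refine ENNReal.ofReal_le_ofReal ?_
  simp only [mul_comm (‖_‖ ^ 2)]
  refine le_trans ?_ (sum_bergmanWeight_mul_sq_norm_le ha b N)
  rw [add_assoc]
  exact le_add_of_nonneg_right (add_nonneg (mul_nonneg (hW1 _) (sq_nonneg _))
    (mul_nonneg (hW1 _) (sq_nonneg _)))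

/-- The norm of division by `(1 - z²)ⁿ`, squared, with respect to `bergmanMass α` and
`bergmanMass (α + 2n)`. -/
noncomputable def hardyConst (α : ℝ) (n : ℕ) : ℝ :=
  ∏ i ∈ Finset.range n, (α + 2 * i + 1) / (α + 2 * i + 2)

theorem hardyConst_succ (α : ℝ) (n : ℕ) :
    hardyConst α (n + 1) = hardyConst α n * ((α + 2 * n + 1) / (α + 2 * n + 2)) :=
  Finset.prod_range_succ _ _

theorem hardyConst_pos {α : ℝ} (hα : -1 < α) (n : ℕ) : 0 < hardyConst α n := by
  refine Finset.prod_pos fun i _ => ?_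
  have : (0 : ℝ) ≤ i := i.cast_nonneg
  exact div_pos (by linarith) (by linarith)

theorem bergmanMass_div_one_sub_sq_pow_le {α : ℝ} (hα : -1 < α) {φ : ℂ → ℂ}
    (hφ : DifferentiableOn ℂ φ disk) (n : ℕ) :
    bergmanMass (α + 2 * n) (fun z => φ z / (1 - z ^ 2) ^ n)
      ≤ ENNReal.ofReal (hardyConst α n) * bergmanMass α φ := by
  induction n with
  | zero => simp [hardyConst]
  | succ n ih =>
    have : (0 : ℝ) ≤ n := n.cast_nonneg
    have hψ : DifferentiableOn ℂ (fun z => φ z / (1 - z ^ 2) ^ (n + 1)) disk :=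
      hφ.div (by fun_prop) fun z hz => pow_ne_zero _ (one_sub_sq_ne_zero hz)
    have heq : Set.EqOn (fun z => (1 - z ^ 2) * (φ z / (1 - z ^ 2) ^ (n + 1)))
        (fun z => φ z / (1 - z ^ 2) ^ n) disk := fun z hz => by
      have := one_sub_sq_ne_zero hz
      field_simp
      ring
    have hstep := bergmanMass_le_one_sub_sq_mul (a := α + 2 * n) (by linarith) hψ
    rw [bergmanMass_congr _ heq] at hstep
    rw [hardyConst_succ, mul_comm (hardyConst α n), ENNReal.ofReal_mul
      (div_nonneg (by linarith) (by linarith)), mul_assoc,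
      show α + 2 * (n + 1 : ℕ) = α + 2 * n + 2 by push_cast; ring]
    exact hstep.trans (mul_right_mono ih)

end Hardy

section EvenSeries

theorem sq_mem_disk {z : ℂ} (hz : z ∈ disk) : z ^ 2 ∈ disk := by
  rw [mem_ball_zero_iff] at hz ⊢
  rw [norm_pow]
  exact pow_lt_one₀ (norm_nonneg z) hz two_ne_zero

theorem HasDiskCoeffs.comp_sq {c : ℕ → ℂ} {f : ℂ → ℂ} (h : HasDiskCoeffs c f) :
    HasDiskCoeffs (Function.extend (fun j => 2 * j) c 0) (fun z => f (z ^ 2)) := by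
  intro z hz
  have hinj : Function.Injective fun j : ℕ => 2 * j := mul_right_injective₀ two_ne_zero
  rw [← hinj.hasSum_iff fun k hk => by
    rw [Function.extend_apply' _ _ _ hk, Pi.zero_apply, zero_mul]]
  simpa only [Function.comp_def, hinj.extend_apply, pow_mul] using h _ (sq_mem_disk hz)

theorem HasDiskCoeffs.bergmanMass_comp_sq {a : ℝ} (ha : -1 < a) {c : ℕ → ℂ} {f : ℂ → ℂ}
    (h : HasDiskCoeffs c f) :
    bergmanMass a (fun z => f (z ^ 2))
      = ENNReal.ofReal Real.pi * ∑' j, ENNReal.ofReal (‖c j‖ ^ 2 * bergmanWeight a (2 * j)) := by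
  have hinj : Function.Injective fun j : ℕ => 2 * j := mul_right_injective₀ two_ne_zero
  rw [h.comp_sq.bergmanMass_eq ha, ← hinj.tsum_eq]
  · simp only [hinj.extend_apply]
  · refine Function.support_subset_iff'.2 fun k hk => ?_
    rw [Function.extend_apply' _ _ _ hk]
    simp

end EvenSeries

section Multichoose

theorem multichoose_eq_ascPochhammer_div (s : ℝ) (j : ℕ) :
    Ring.multichoose s j = (ascPochhammer ℝ j).eval s / j.factorial := by
  rw [eq_div_iff (by positivity), ← Polynomial.ascPochhammer_smeval_eq_eval,
    ← Ring.factorial_nsmul_multichoose_eq_ascPochhammer, nsmul_eq_mul, mul_comm]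

theorem multichoose_pos {s : ℝ} (hs : 0 < s) (j : ℕ) : 0 < Ring.multichoose s j := by
  rw [multichoose_eq_ascPochhammer_div]
  exact div_pos (ascPochhammer_pos j s hs) (by positivity)

theorem continuous_multichoose (j : ℕ) : Continuous fun s : ℝ => Ring.multichoose s j := by
  simp only [multichoose_eq_ascPochhammer_div]
  fun_prop

theorem multichoose_succ_right (s : ℝ) (j : ℕ) :
    Ring.multichoose s (j + 1) * (j + 1) = Ring.multichoose s j * (s + j) := by
  rw [multichoose_eq_ascPochhammer_div, multichoose_eq_ascPochhammer_div, ascPochhammer_succ_eval,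
    Nat.factorial_succ]
  push_cast
  field_simp

theorem multichoose_add_one_left (s : ℝ) (j : ℕ) :
    Ring.multichoose (s + 1) j * s = Ring.multichoose s (j + 1) * (j + 1) := by
  rw [multichoose_eq_ascPochhammer_div, multichoose_eq_ascPochhammer_div, ascPochhammer_succ_left,
    Nat.factorial_succ]
  simp only [Polynomial.eval_mul, Polynomial.eval_X, Polynomial.eval_comp, Polynomial.eval_add,
    Polynomial.eval_one]
  push_cast
  field_simp

theorem hasDiskCoeffs_one_sub_cpow (s : ℝ) :
    HasDiskCoeffs (fun j => (Ring.multichoose s j : ℝ)) (fun z => (1 - z) ^ (-s : ℂ)) := by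
  intro z hz
  have h := (Complex.one_div_one_sub_cpow_hasFPowerSeriesOnBall_zero s).hasSum (y := z)
    (by simpa [enorm_eq_nnnorm, ← NNReal.coe_lt_coe] using hz)
  simpa [FormalMultilinearSeries.ofScalars_apply_eq, Complex.cpow_neg, Ring.multichoose_eq,
    Complex.ofReal_choose, mul_comm] using h

end Multichoose

section Raabe

theorem summable_of_eventually_mul_le_sub {T : ℕ → ℝ} (hT : ∀ j, 0 ≤ T j) {c : ℝ} (hc : 0 < c)
    (h : ∀ᶠ j : ℕ in atTop, c * T j ≤ j * T j - (j + 1 : ℕ) * T (j + 1)) : Summable T := by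
  obtain ⟨N, hN⟩ := eventually_atTop.1 h
  refine (summable_nat_add_iff N).1 ?_
  refine summable_of_sum_range_le (c := N * T N / c) (fun j => hT _) fun n => ?_
  rw [le_div_iff₀' hc, Finset.mul_sum]
  calc ∑ i ∈ Finset.range n, c * T (i + N)
      ≤ ∑ i ∈ Finset.range n, ((i + N : ℕ) * T (i + N) - (i + 1 + N : ℕ) * T (i + 1 + N)) := by
        refine Finset.sum_le_sum fun i _ => ?_
        rw [add_right_comm i 1 N]
        exact hN _ (Nat.le_add_left N i)
    _ = N * T N - (n + N : ℕ) * T (n + N) := by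
        rw [Finset.sum_range_sub' (fun i => (i + N : ℕ) * T (i + N)), zero_add]
    _ ≤ N * T N := sub_le_self _ (mul_nonneg (Nat.cast_nonneg _) (hT _))

theorem not_summable_of_mul_le_mul_succ {T : ℕ → ℝ} (h1 : 0 < T 1)
    (h : ∀ j : ℕ, j * T j ≤ (j + 1 : ℕ) * T (j + 1)) : ¬ Summable T := by
  intro hT
  have hmono : Monotone fun j : ℕ => j * T j := monotone_nat_of_le_succ h
  refine Real.not_summable_natCast_inv ?_
  refine (summable_mul_left_iff h1.ne').1 ?_
  refine (summable_nat_add_iff 1).1 (Summable.of_nonneg_of_le (fun j => by positivity) (fun j => ?_)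
    ((summable_nat_add_iff 1).2 hT))
  have hj := hmono (Nat.le_add_left 1 j)
  rw [← div_eq_mul_inv, div_le_iff₀' (by positivity)]
  simpa using hj

end Raabe

section EvenWeights

theorem bergmanWeight_two_mul_succ {a : ℝ} (ha : -1 < a) (j : ℕ) :
    bergmanWeight a (2 * (j + 1)) * ((j + a / 2 + 1) * (j + a / 2 + 3 / 2))
      = (j + 1 / 2) * (j + 1) * bergmanWeight a (2 * j) := by
  have h1 := bergmanWeight_succ ha (2 * j)
  have h2 := bergmanWeight_succ ha (2 * j + 1)
  push_cast at h1 h2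
  rw [mul_add_one]
  linear_combination (2 * j + a + 2) / 4 * h2 + (2 * j + 2) / 4 * h1

theorem bergmanWeight_add_two {a : ℝ} (ha : -1 < a) (k : ℕ) :
    bergmanWeight (a + 2) k * ((k + 1) * (k + 2))
      = (a + 1) * (a + 2) * bergmanWeight a (k + 2) := by
  have h1 := bergmanWeight_succ ha k
  have h2 := bergmanWeight_succ ha (k + 1)
  have h3 := bergmanWeight_add_one ha k
  have h4 := bergmanWeight_add_one (a := a + 1) (by linarith) k
  rw [add_assoc a 1 1, one_add_one_eq_two] at h4
  push_cast at h2
  have hk : (k + a + 2 : ℝ) * (k + a + 3) ≠ 0 := by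
    have := k.cast_nonneg (α := ℝ)
    exact mul_ne_zero (by linarith) (by linarith)
  refine mul_right_cancel₀ hk ?_
  linear_combination (k + 1) * (k + 2) * ((k + a + 2) * h4 + (a + 2) * h3)
    - (a + 1) * (a + 2) * ((k + a + 2) * h2 + (k + 2) * h1)

end EvenWeights

section Extremal

/-- The function `(1 - z²)^(-s)`, extremal for multipliers on `A²_a` as `s` increases to
`a / 2 + 1`, the first exponent for which it is not in `A²_a`. -/
noncomputable def extremalFun (s : ℝ) (z : ℂ) : ℂ :=
  (1 - z ^ 2) ^ (-s : ℂ)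

/-- The contribution of the coefficient of `z ^ (2 * j)` to `bergmanMass a (extremalFun s) / π`. -/
noncomputable def extremalTerm (a s : ℝ) (j : ℕ) : ℝ :=
  Ring.multichoose s j ^ 2 * bergmanWeight a (2 * j)

variable {a s : ℝ}

theorem bergmanMass_extremalFun (ha : -1 < a) (s : ℝ) :
    bergmanMass a (extremalFun s)
      = ENNReal.ofReal Real.pi * ∑' j, ENNReal.ofReal (extremalTerm a s j) := by
  refine ((hasDiskCoeffs_one_sub_cpow s).bergmanMass_comp_sq ha).trans ?_
  simp only [Complex.norm_real, Real.norm_eq_abs, sq_abs, extremalTerm]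

theorem differentiableOn_extremalFun (s : ℝ) : DifferentiableOn ℂ (extremalFun s) disk :=
  (hasDiskCoeffs_one_sub_cpow s).comp_sq.differentiableOn

theorem extremalTerm_pos (ha : -1 < a) (hs : 0 < s) (j : ℕ) : 0 < extremalTerm a s j :=
  mul_pos (pow_pos (multichoose_pos hs j) 2) (bergmanWeight_pos ha _)

theorem extremalTerm_zero (ha : -1 < a) : extremalTerm a s 0 = 1 / (a + 1) := by
  simp [extremalTerm, bergmanWeight_zero ha]

theorem continuous_extremalTerm (a : ℝ) (j : ℕ) : Continuous fun s => extremalTerm a s j :=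
  ((continuous_multichoose j).pow 2).mul_const _

theorem extremalTerm_succ (ha : -1 < a) (s : ℝ) (j : ℕ) :
    (j + 1) * extremalTerm a s (j + 1) * ((j + a / 2 + 1) * (j + a / 2 + 3 / 2))
      = (s + j) ^ 2 * (j + 1 / 2) * extremalTerm a s j := by
  have hc := congrArg (· ^ 2) (multichoose_succ_right s j)
  simp only [mul_pow] at hc
  refine mul_right_cancel₀ (Nat.cast_add_one_ne_zero j : (j : ℝ) + 1 ≠ 0) ?_
  simp only [extremalTerm]
  linear_combination
    Ring.multichoose s (j + 1) ^ 2 * (j + 1) ^ 2 * bergmanWeight_two_mul_succ ha j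
    + (j + 1 / 2) * (j + 1) * bergmanWeight a (2 * j) * hc

theorem summable_extremalTerm (ha : -1 < a) (hs : 0 < s) (hsa : s < a / 2 + 1) :
    Summable (extremalTerm a s) := by
  have hc : 0 < (a / 2 + 1 - s) / 2 := by linarith
  refine summable_of_eventually_mul_le_sub (fun j => (extremalTerm_pos ha hs j).le) hc ?_
  filter_upwards [tendsto_natCast_atTop_atTop.eventually_ge_atTop
    ((s / 2 + (a / 2 + 1 - s) / 2 * (a / 2 + 3 / 2)) / ((a / 2 + 1 - s) / 2))] with j hj
  rw [div_le_iff₀ hc] at hj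
  have : (0 : ℝ) ≤ j := j.cast_nonneg
  have hT := extremalTerm_pos ha hs j
  have hratio : (j + 1) * extremalTerm a s (j + 1) * (j + a / 2 + 3 / 2)
      ≤ (s + j) * (j + 1 / 2) * extremalTerm a s j := by
    refine le_of_mul_le_mul_right ?_ (show 0 < j + a / 2 + 1 by linarith)
    calc (j + 1) * extremalTerm a s (j + 1) * (j + a / 2 + 3 / 2) * (j + a / 2 + 1)
        = (s + j) * (j + 1 / 2) * extremalTerm a s j * (s + j) := by
          linear_combination extremalTerm_succ ha s j
      _ ≤ (s + j) * (j + 1 / 2) * extremalTerm a s j * (j + a / 2 + 1) :=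
          mul_le_mul_of_nonneg_left (by linarith) (by positivity)
  refine le_of_mul_le_mul_right ?_ (show 0 < j + a / 2 + 3 / 2 by linarith)
  push_cast
  have := mul_le_mul_of_nonneg_right hj hT.le
  linarith

theorem not_summable_extremalTerm (ha : -1 < a) : ¬ Summable (extremalTerm a (a / 2 + 1)) := by
  have hb : 0 < a / 2 + 1 := by linarith
  refine not_summable_of_mul_le_mul_succ (extremalTerm_pos ha hb 1) fun j => ?_
  have : (0 : ℝ) ≤ j := j.cast_nonneg
  have hT := extremalTerm_pos ha hb j
  have hratio : (j + 1) * extremalTerm a (a / 2 + 1) (j + 1) * (j + a / 2 + 3 / 2)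
      = (j + a / 2 + 1) * (j + 1 / 2) * extremalTerm a (a / 2 + 1) j :=
    mul_right_cancel₀ (show j + a / 2 + 1 ≠ 0 by linarith) <| by
      linear_combination extremalTerm_succ ha (a / 2 + 1) j
  refine le_of_mul_le_mul_right ?_ (show 0 < j + a / 2 + 3 / 2 by linarith)
  push_cast
  rw [hratio]
  linarith [mul_pos hb hT]

theorem bergmanMass_extremalFun_lt_top (ha : -1 < a) (hs : 0 < s) (hsa : s < a / 2 + 1) :
    bergmanMass a (extremalFun s) < ⊤ := by
  rw [bergmanMass_extremalFun ha]
  exact ENNReal.mul_lt_top ENNReal.ofReal_lt_top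
    (summable_extremalTerm ha hs hsa).tsum_ofReal_lt_top

theorem bergmanMass_extremalFun_eq_top (ha : -1 < a) :
    bergmanMass a (extremalFun (a / 2 + 1)) = ⊤ := by
  rw [bergmanMass_extremalFun ha, ENNReal.mul_eq_top]
  refine .inl ⟨(ENNReal.ofReal_pos.2 Real.pi_pos).ne', ?_⟩
  by_contra h
  refine not_summable_extremalTerm ha ((ENNReal.summable_toReal h).congr fun j => ?_)
  exact ENNReal.toReal_ofReal (extremalTerm_pos ha (by linarith) j).le

theorem lowerSemicontinuous_bergmanMass_extremalFun (ha : -1 < a) :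
    LowerSemicontinuous fun s => bergmanMass a (extremalFun s) := by
  simp only [bergmanMass_extremalFun ha, ← ENNReal.tsum_mul_left]
  refine lowerSemicontinuous_tsum fun j => Continuous.lowerSemicontinuous ?_
  exact (ENNReal.continuous_const_mul ENNReal.ofReal_ne_top).comp
    (ENNReal.continuous_ofReal.comp (continuous_extremalTerm a j))

theorem exists_lt_bergmanMass_extremalFun (ha : -1 < a) {C : ℝ≥0∞} (hC : C < ⊤) :
    ∃ s ∈ Set.Ioo 0 (a / 2 + 1), C < bergmanMass a (extremalFun s) := by
  have hlarge := lowerSemicontinuous_bergmanMass_extremalFun ha (a / 2 + 1) C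
    (hC.trans_eq (bergmanMass_extremalFun_eq_top ha).symm)
  have hleft : Set.Ioo 0 (a / 2 + 1) ∈ 𝓝[<] (a / 2 + 1) := Ioo_mem_nhdsLT (by linarith)
  exact (Eventually.and hleft (hlarge.filter_mono nhdsWithin_le_nhds)).exists

theorem mul_extremalTerm_succ_le (ha : -1 < a) (hs : 0 < s) (hsa : s ≤ a / 2 + 1) (j : ℕ) :
    (a + 1) / (a + 2) * extremalTerm a s (j + 1) ≤ extremalTerm (a + 2) (s + 1) j := by
  have hc := congrArg (· ^ 2) (multichoose_add_one_left s j)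
  simp only [mul_pow] at hc
  have hW := bergmanWeight_add_two ha (2 * j)
  have hshift : extremalTerm (a + 2) (s + 1) j * (2 * s ^ 2 * (2 * j + 1))
      = (j + 1) * ((a + 1) * (a + 2)) * extremalTerm a s (j + 1) := by
    refine mul_right_cancel₀ (Nat.cast_add_one_ne_zero j : (j : ℝ) + 1 ≠ 0) ?_
    push_cast at hW
    simp only [extremalTerm, mul_add_one]
    linear_combination 2 * (2 * j + 1) * (j + 1) * bergmanWeight (a + 2) (2 * j) * hc
      + Ring.multichoose s (j + 1) ^ 2 * (j + 1) ^ 2 * hW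
  have ha1 : 0 < a + 1 := by linarith
  have hT := extremalTerm_pos ha hs (j + 1)
  have hs2 : (2 * s) ^ 2 ≤ (a + 2) ^ 2 := by gcongr; linarith
  refine le_of_mul_le_mul_right ?_ (show 0 < 2 * s ^ 2 * (2 * j + 1) by positivity)
  calc (a + 1) / (a + 2) * extremalTerm a s (j + 1) * (2 * s ^ 2 * (2 * j + 1))
      ≤ (a + 1) / (a + 2) * extremalTerm a s (j + 1) * ((a + 2) ^ 2 * (j + 1)) := by
        have : 0 < a + 2 := by linarith
        refine mul_le_mul_of_nonneg_left ?_ (by positivity)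
        nlinarith [mul_nonneg (sub_nonneg.2 hs2) (j.cast_nonneg (α := ℝ)), sq_nonneg s]
    _ = extremalTerm (a + 2) (s + 1) j * (2 * s ^ 2 * (2 * j + 1)) := by
        rw [hshift]
        field_simp

theorem mul_bergmanMass_extremalFun_le (ha : -1 < a) (hs : 0 < s) (hsa : s ≤ a / 2 + 1) :
    ENNReal.ofReal ((a + 1) / (a + 2)) * bergmanMass a (extremalFun s)
      ≤ bergmanMass (a + 2) (extremalFun (s + 1)) + ENNReal.ofReal Real.pi := by
  have hc : 0 ≤ (a + 1) / (a + 2) := div_nonneg (by linarith) (by linarith)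
  have hzero : (a + 1) / (a + 2) * extremalTerm a s 0 ≤ 1 := by
    rw [extremalTerm_zero ha, mul_one_div, div_right_comm, div_self (by linarith)]
    exact (div_le_one (by linarith)).2 (by linarith)
  rw [bergmanMass_extremalFun ha, bergmanMass_extremalFun (by linarith), mul_left_comm,
    ← ENNReal.tsum_mul_left, ← mul_add_one]
  refine mul_le_mul_right ?_ _
  simp only [← ENNReal.ofReal_mul hc]
  rw [tsum_eq_zero_add' ENNReal.summable, add_comm]
  exact add_le_add (ENNReal.tsum_le_tsum fun j =>
    ENNReal.ofReal_le_ofReal (mul_extremalTerm_succ_le ha hs hsa j)) (by simpa using hzero)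

theorem hardyConst_mul_bergmanMass_extremalFun_le (ha : -1 < a) (hs : 0 < s)
    (hsa : s ≤ a / 2 + 1) (n : ℕ) :
    ENNReal.ofReal (hardyConst a n) * bergmanMass a (extremalFun s)
      ≤ bergmanMass (a + 2 * n) (extremalFun (s + n)) + n * ENNReal.ofReal Real.pi := by
  induction n with
  | zero => simp [hardyConst]
  | succ n ih =>
    have : (0 : ℝ) ≤ n := n.cast_nonneg
    have hstep := mul_bergmanMass_extremalFun_le (a := a + 2 * n) (s := s + n) (by linarith)
      (by linarith) (by linarith)
    have hc1 : ENNReal.ofReal ((a + 2 * n + 1) / (a + 2 * n + 2)) ≤ 1 :=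
      ENNReal.ofReal_le_one.2 ((div_le_one (by linarith)).2 (by linarith))
    rw [hardyConst_succ, ENNReal.ofReal_mul (hardyConst_pos ha n).le, mul_right_comm, mul_comm]
    push_cast
    calc _ ≤ ENNReal.ofReal ((a + 2 * n + 1) / (a + 2 * n + 2)) *
            (bergmanMass (a + 2 * n) (extremalFun (s + n)) + n * ENNReal.ofReal Real.pi) :=
          mul_le_mul_right ih _
      _ ≤ bergmanMass (a + 2 * n + 2) (extremalFun (s + n + 1)) + ENNReal.ofReal Real.pi
            + 1 * (n * ENNReal.ofReal Real.pi) := by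
          rw [mul_add]
          gcongr
      _ = _ := by
          rw [show a + 2 * n + 2 = a + 2 * (n + 1) by ring, add_assoc s]
          ring

theorem norm_extremalFun (s : ℝ) (z : ℂ) :
    ‖extremalFun s z‖ = ‖1 - z ^ 2‖ ^ (-s) := by
  rw [extremalFun, ← Complex.ofReal_neg, Complex.norm_cpow_real]

theorem extremalFun_add_natCast {z : ℂ} (hz : z ∈ disk) (s : ℝ) (n : ℕ) :
    extremalFun (s + n) z = extremalFun s z / (1 - z ^ 2) ^ n := by
  rw [extremalFun, extremalFun, Complex.ofReal_add, Complex.ofReal_natCast, neg_add',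
    Complex.cpow_sub _ _ (one_sub_sq_ne_zero hz), Complex.cpow_natCast]

end Extremal

section Multipliers

variable {α β a : ℝ} {g φ ψ : ℂ → ℂ}

theorem bergmanDensity_nonneg (a : ℝ) (φ : ℂ → ℂ) {z : ℂ} (hz : z ∈ disk) :
    0 ≤ bergmanDensity a φ z :=
  mul_nonneg (sq_nonneg _) (Real.rpow_nonneg (one_sub_sq_norm_pos hz).le _)

theorem ae_bergmanDensity_nonneg (a : ℝ) (φ : ℂ → ℂ) :
    0 ≤ᵐ[volume.restrict disk] bergmanDensity a φ :=
  (ae_restrict_mem measurableSet_ball).mono fun _ => bergmanDensity_nonneg a φ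

theorem aestronglyMeasurable_bergmanDensity (a : ℝ) (hφ : ContinuousOn φ disk) :
    AEStronglyMeasurable (bergmanDensity a φ) (volume.restrict disk) :=
  (continuousOn_bergmanDensity a hφ).aestronglyMeasurable measurableSet_ball

theorem memBergman_iff_bergmanMass_lt_top :
    MemBergman a φ ↔ DifferentiableOn ℂ φ disk ∧ bergmanMass a φ < ⊤ := by
  refine and_congr_right fun hφ => ?_
  rw [IntegrableOn, Integrable, hasFiniteIntegral_iff_ofReal (ae_bergmanDensity_nonneg a φ)]
  exact and_iff_right (aestronglyMeasurable_bergmanDensity a hφ.continuousOn)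

theorem bergmanNorm_eq_sqrt_bergmanMass (hφ : ContinuousOn φ disk) :
    bergmanNorm a φ = √((a + 1) * ((bergmanMass a φ).toReal / Real.pi)) := by
  rw [bergmanNorm, integral_eq_lintegral_of_nonneg_ae (ae_bergmanDensity_nonneg a φ)
    (aestronglyMeasurable_bergmanDensity a hφ), bergmanMass]

theorem sqrt_mul_bergmanNorm (hα : -1 < α) (hβ : -1 < β) {C : ℝ} (hC : 0 ≤ C)
    (hφ : ContinuousOn φ disk) :
    √(C * ((β + 1) / (α + 1))) * bergmanNorm α φ
      = √((β + 1) * ((ENNReal.ofReal C * bergmanMass α φ).toReal / Real.pi)) := by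
  have hα1 : 0 < α + 1 := by linarith
  have hβ1 : 0 < β + 1 := by linarith
  rw [bergmanNorm_eq_sqrt_bergmanMass hφ, ← Real.sqrt_mul (by positivity), ENNReal.toReal_mul,
    ENNReal.toReal_ofReal hC]
  congr 1
  field_simp

theorem bergmanNorm_le_sqrt_mul (hα : -1 < α) (hβ : -1 < β) {C : ℝ} (hC : 0 ≤ C)
    (hφ : MemBergman α φ) (hψ : ContinuousOn ψ disk)
    (h : bergmanMass β ψ ≤ ENNReal.ofReal C * bergmanMass α φ) :
    bergmanNorm β ψ ≤ √(C * ((β + 1) / (α + 1))) * bergmanNorm α φ := by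
  have hβ1 : 0 ≤ β + 1 := by linarith
  have hfin := (memBergman_iff_bergmanMass_lt_top.1 hφ).2
  rw [sqrt_mul_bergmanNorm hα hβ hC hφ.1.continuousOn, bergmanNorm_eq_sqrt_bergmanMass hψ]
  gcongr
  exact ENNReal.mul_ne_top ENNReal.ofReal_ne_top hfin.ne

theorem sqrt_mul_le_bergmanNorm (hα : -1 < α) (hβ : -1 < β) {C : ℝ} (hC : 0 ≤ C)
    (hφ : ContinuousOn φ disk) (hψ : MemBergman β ψ)
    (h : ENNReal.ofReal C * bergmanMass α φ ≤ bergmanMass β ψ) :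
    √(C * ((β + 1) / (α + 1))) * bergmanNorm α φ ≤ bergmanNorm β ψ := by
  have hβ1 : 0 ≤ β + 1 := by linarith
  have hfin := (memBergman_iff_bergmanMass_lt_top.1 hψ).2
  rw [sqrt_mul_bergmanNorm hα hβ hC hφ, bergmanNorm_eq_sqrt_bergmanMass hψ.1.continuousOn]
  gcongr
  exact hfin.ne

theorem bergmanNorm_pos (ha : -1 < a) (hφ : MemBergman a φ) (h0 : bergmanMass a φ ≠ 0) :
    0 < bergmanNorm a φ := by
  have hfin := (memBergman_iff_bergmanMass_lt_top.1 hφ).2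
  have ha1 : 0 < a + 1 := by linarith
  rw [bergmanNorm_eq_sqrt_bergmanMass hφ.1.continuousOn]
  have := ENNReal.toReal_pos h0 hfin.ne
  positivity

theorem exists_ne_zero_of_bergmanMass_ne_zero (h0 : bergmanMass a φ ≠ 0) :
    ∃ z ∈ disk, φ z ≠ 0 := by
  contrapose! h0
  rw [bergmanMass_congr a (ψ := 0) h0]
  simp [bergmanMass, bergmanDensity]

theorem isMultiplier_of_bergmanMass_mul_le (hα : -1 < α) (hβ : -1 < β)
    (hg : DifferentiableOn ℂ g disk) {C : ℝ} (hC : 0 ≤ C)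
    (hle : ∀ φ, DifferentiableOn ℂ φ disk →
      bergmanMass β (fun z => g z * φ z) ≤ ENNReal.ofReal C * bergmanMass α φ) :
    IsMultiplier α β g := by
  refine ⟨hg, fun φ hφ => ?_, _, fun φ hφ =>
    bergmanNorm_le_sqrt_mul hα hβ hC hφ (hg.mul hφ.1).continuousOn (hle φ hφ.1)⟩
  obtain ⟨hd, hfin⟩ := memBergman_iff_bergmanMass_lt_top.1 hφ
  exact memBergman_iff_bergmanMass_lt_top.2
    ⟨hg.mul hd, (hle φ hd).trans_lt (ENNReal.mul_lt_top ENNReal.ofReal_lt_top hfin)⟩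

theorem multiplierNorm_eq_sqrt (hα : -1 < α) (hβ : -1 < β) (hg : DifferentiableOn ℂ g disk)
    {C : ℝ} (hC : 0 < C)
    (hle : ∀ φ, DifferentiableOn ℂ φ disk →
      bergmanMass β (fun z => g z * φ z) ≤ ENNReal.ofReal C * bergmanMass α φ)
    (hge : ∀ κ ∈ Set.Ioo 0 C, ∃ φ, MemBergman α φ ∧ bergmanMass α φ ≠ 0 ∧
      ENNReal.ofReal κ * bergmanMass α φ ≤ bergmanMass β (fun z => g z * φ z)) :
    multiplierNorm α β g = √(C * ((β + 1) / (α + 1))) := by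
  have hmult := isMultiplier_of_bergmanMass_mul_le hα hβ hg hC.le hle
  have hratio : ∀ κ ∈ Set.Ioo 0 C, ∃ φ, MemBergman α φ ∧ (∃ z ∈ disk, φ z ≠ 0) ∧
      √(κ * ((β + 1) / (α + 1))) ≤ bergmanNorm β (fun z => g z * φ z) / bergmanNorm α φ := by
    intro κ hκ
    obtain ⟨φ, hφ, hφ0, hκφ⟩ := hge κ hκ
    refine ⟨φ, hφ, exists_ne_zero_of_bergmanMass_ne_zero hφ0, ?_⟩
    rw [le_div_iff₀ (bergmanNorm_pos hα hφ hφ0)]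
    exact sqrt_mul_le_bergmanNorm hα hβ hκ.1.le hφ.1.continuousOn (hmult.2.1 φ hφ) hκφ
  refine csSup_eq_of_forall_le_of_forall_lt_exists_gt ?_ ?_ ?_
  · obtain ⟨φ, hφ, hφ0, -⟩ := hratio (C / 2) ⟨half_pos hC, half_lt_self hC⟩
    exact ⟨_, φ, hφ, hφ0, rfl⟩
  · rintro _ ⟨φ, hφ, -, rfl⟩
    exact div_le_of_le_mul₀ (Real.sqrt_nonneg _) (Real.sqrt_nonneg _)
      (bergmanNorm_le_sqrt_mul hα hβ hC.le hφ (hg.mul hφ.1).continuousOn (hle φ hφ.1))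
  · intro v hv
    have hcont : Continuous fun κ : ℝ => √(κ * ((β + 1) / (α + 1))) := by fun_prop
    have hnear : ∀ᶠ κ in 𝓝[<] C, v < √(κ * ((β + 1) / (α + 1))) :=
      (hcont.continuousAt.eventually_const_lt hv).filter_mono nhdsWithin_le_nhds
    obtain ⟨κ, hvκ, hκ⟩ := (hnear.and (Ioo_mem_nhdsLT hC)).exists
    obtain ⟨φ, hφ, hφ0, hκφ⟩ := hratio κ hκ
    exact ⟨_, ⟨φ, hφ, hφ0, rfl⟩, hvκ.trans_le hκφ⟩

end Multipliers

section BoundaryValues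

theorem bergmanMass_le_add {a : ℝ} {φ ψ χ : ℂ → ℂ} (hψ : ContinuousOn ψ disk)
    (h : ∀ z ∈ disk, ‖φ z‖ ^ 2 ≤ ‖ψ z‖ ^ 2 + ‖χ z‖ ^ 2) :
    bergmanMass a φ ≤ bergmanMass a ψ + bergmanMass a χ := by
  rw [bergmanMass, bergmanMass, bergmanMass, ← lintegral_add_left'
    (aestronglyMeasurable_bergmanDensity a hψ).aemeasurable.ennreal_ofReal]
  refine setLIntegral_mono' measurableSet_ball fun z hz => ?_
  rw [← ENNReal.ofReal_add (bergmanDensity_nonneg a ψ hz) (bergmanDensity_nonneg a χ hz)]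
  refine ENNReal.ofReal_le_ofReal ?_
  rw [bergmanDensity, bergmanDensity, bergmanDensity, ← add_mul]
  exact mul_le_mul_of_nonneg_right (h z hz) (Real.rpow_nonneg (one_sub_sq_norm_pos hz).le _)

theorem bergmanMass_mono {a : ℝ} {φ ψ : ℂ → ℂ} (h : ∀ z ∈ disk, ‖φ z‖ ≤ ‖ψ z‖) :
    bergmanMass a φ ≤ bergmanMass a ψ := by
  refine setLIntegral_mono' measurableSet_ball fun z hz => ENNReal.ofReal_le_ofReal ?_
  have := (one_sub_sq_norm_pos hz).le
  have := h z hz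
  rw [bergmanDensity, bergmanDensity]
  gcongr

theorem bergmanMass_const_mul (a : ℝ) (c : ℂ) (φ : ℂ → ℂ) :
    bergmanMass a (fun z => c * φ z) = ENNReal.ofReal (‖c‖ ^ 2) * bergmanMass a φ := by
  simp only [bergmanMass, bergmanDensity, norm_mul, mul_pow, mul_assoc,
    ENNReal.ofReal_mul (sq_nonneg ‖c‖)]
  exact lintegral_const_mul' _ _ ENNReal.ofReal_ne_top

theorem bergmanMass_const_lt_top {a : ℝ} (ha : -1 < a) (c : ℂ) :
    bergmanMass a (fun _ => c) < ⊤ := by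
  have hcoeff : HasDiskCoeffs (Pi.single 0 c) fun _ => c := fun z _ => by
    convert hasSum_single (f := fun k => (Pi.single 0 c : ℕ → ℂ) k * z ^ k) 0 ?_ using 1
    · simp
    · intro k hk
      simp [hk]
  rw [hcoeff.bergmanMass_eq ha, tsum_eq_single 0 fun k hk => by simp [hk]]
  exact ENNReal.mul_lt_top ENNReal.ofReal_lt_top ENNReal.ofReal_lt_top

theorem exists_forall_norm_one_sub_sq_lt {p : ℂ → Prop} (hone : ∀ᶠ z in 𝓝[disk] 1, p z)
    (hneg : ∀ᶠ z in 𝓝[disk] (-1), p z) :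
    ∃ δ > 0, ∀ z ∈ disk, ‖1 - z ^ 2‖ < δ → p z := by
  obtain ⟨δ₁, hδ₁, h₁⟩ := Metric.mem_nhdsWithin_iff.1 hone
  obtain ⟨δ₂, hδ₂, h₂⟩ := Metric.mem_nhdsWithin_iff.1 hneg
  refine ⟨δ₁ * δ₂, mul_pos hδ₁ hδ₂, fun z hz hlt => ?_⟩
  rw [show 1 - z ^ 2 = (1 - z) * (z - -1) by ring, norm_mul] at hlt
  rcases lt_or_ge ‖1 - z‖ δ₁ with h | h
  · exact h₁ ⟨by rwa [mem_ball_iff_norm'], hz⟩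
  · have hlt₂ : ‖z - -1‖ < δ₂ := lt_of_mul_lt_mul_left
      ((mul_le_mul_of_nonneg_right h (norm_nonneg _)).trans_lt hlt) hδ₁.le
    exact h₂ ⟨by rwa [mem_ball_iff_norm], hz⟩

variable {α A : ℝ} {n : ℕ} {g : ℂ → ℂ}

theorem bergmanMass_mul_le_of_norm_le (hα : -1 < α)
    (hle : ∀ z ∈ disk, ‖(1 - z ^ 2) ^ n * g z‖ ≤ A) {φ : ℂ → ℂ}
    (hφ : DifferentiableOn ℂ φ disk) :
    bergmanMass (α + 2 * n) (fun z => g z * φ z)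
      ≤ ENNReal.ofReal (A ^ 2 * hardyConst α n) * bergmanMass α φ := by
  have hA : 0 ≤ A := (norm_nonneg _).trans (hle 0 (Metric.mem_ball_self one_pos))
  calc bergmanMass (α + 2 * n) (fun z => g z * φ z)
      ≤ bergmanMass (α + 2 * n) (fun z => A * (φ z / (1 - z ^ 2) ^ n)) := by
        refine bergmanMass_mono fun z hz => ?_
        have h0 := pow_ne_zero n (one_sub_sq_ne_zero hz)
        rw [show g z * φ z = (1 - z ^ 2) ^ n * g z * (φ z / (1 - z ^ 2) ^ n) by field_simp,
          norm_mul, norm_mul (A : ℂ), Complex.norm_of_nonneg hA]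
        exact mul_le_mul_of_nonneg_right (hle z hz) (norm_nonneg _)
    _ = ENNReal.ofReal (A ^ 2) * bergmanMass (α + 2 * n) (fun z => φ z / (1 - z ^ 2) ^ n) := by
        rw [bergmanMass_const_mul, Complex.norm_of_nonneg hA]
    _ ≤ ENNReal.ofReal (A ^ 2) * (ENNReal.ofReal (hardyConst α n) * bergmanMass α φ) :=
        mul_le_mul_right (bergmanMass_div_one_sub_sq_pow_le hα hφ n) _
    _ = _ := by rw [← mul_assoc, ← ENNReal.ofReal_mul (sq_nonneg A)]

theorem norm_extremalFun_le_rpow {s t δ : ℝ} (hs : 0 ≤ s) (hst : s ≤ t) (hδ : 0 < δ) (hδ1 : δ ≤ 1)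
    {z : ℂ} (hz : δ ≤ ‖1 - z ^ 2‖) : ‖extremalFun s z‖ ≤ δ ^ (-t) := by
  rw [norm_extremalFun]
  calc ‖1 - z ^ 2‖ ^ (-s) ≤ δ ^ (-s) := Real.rpow_le_rpow_of_nonpos hδ hz (neg_nonpos.2 hs)
    _ ≤ δ ^ (-t) := Real.rpow_le_rpow_of_exponent_ge hδ hδ1 (neg_le_neg hst)

theorem exists_forall_norm_extremalFun_sq_le {B : ℝ} (hB : 0 ≤ B)
    (hone : ∀ᶠ z in 𝓝[disk] 1, B ≤ ‖(1 - z ^ 2) ^ n * g z‖)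
    (hneg : ∀ᶠ z in 𝓝[disk] (-1), B ≤ ‖(1 - z ^ 2) ^ n * g z‖) (S : ℝ) :
    ∃ K : ℝ, ∀ s ∈ Set.Ioo 0 S, ∀ z ∈ disk,
      ‖B * extremalFun (s + n) z‖ ^ 2 ≤ ‖g z * extremalFun s z‖ ^ 2 + ‖(K : ℂ)‖ ^ 2 := by
  obtain ⟨δ, hδ, hδB⟩ := exists_forall_norm_one_sub_sq_lt hone hneg
  have hmin : 0 < min δ 1 := lt_min hδ one_pos
  refine ⟨B * min δ 1 ^ (-(S + n)), fun s hs z hz => ?_⟩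
  rcases lt_or_ge ‖1 - z ^ 2‖ δ with hlt | hge
  · refine le_add_of_le_of_nonneg (pow_le_pow_left₀ (norm_nonneg _) ?_ 2) (sq_nonneg _)
    have h0 := pow_ne_zero n (one_sub_sq_ne_zero hz)
    rw [show g z * extremalFun s z = (1 - z ^ 2) ^ n * g z * extremalFun (s + n) z by
      rw [extremalFun_add_natCast hz]; field_simp, norm_mul, norm_mul, Complex.norm_of_nonneg hB]
    exact mul_le_mul_of_nonneg_right (hδB z hz hlt) (norm_nonneg _)
  · refine le_add_of_nonneg_of_le (sq_nonneg _) (pow_le_pow_left₀ (norm_nonneg _) ?_ 2)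
    rw [norm_mul, Complex.norm_of_nonneg hB, Complex.norm_of_nonneg (by positivity)]
    exact mul_le_mul_of_nonneg_left (norm_extremalFun_le_rpow (add_nonneg hs.1.le n.cast_nonneg)
      (add_le_add_left hs.2.le _) hmin (min_le_right δ 1) (min_le_of_left_le hge)) hB

theorem exists_forall_mul_bergmanMass_extremalFun_le (hα : -1 < α)
    (hg : DifferentiableOn ℂ g disk) {B : ℝ} (hB : 0 ≤ B)
    (hone : ∀ᶠ z in 𝓝[disk] 1, B ≤ ‖(1 - z ^ 2) ^ n * g z‖)
    (hneg : ∀ᶠ z in 𝓝[disk] (-1), B ≤ ‖(1 - z ^ 2) ^ n * g z‖) :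
    ∃ M < ⊤, ∀ s ∈ Set.Ioo 0 (α / 2 + 1),
      ENNReal.ofReal (B ^ 2 * hardyConst α n) * bergmanMass α (extremalFun s)
        ≤ bergmanMass (α + 2 * n) (fun z => g z * extremalFun s z) + M := by
  obtain ⟨K, hK⟩ := exists_forall_norm_extremalFun_sq_le hB hone hneg (α / 2 + 1)
  have : (0 : ℝ) ≤ n := n.cast_nonneg
  refine ⟨bergmanMass (α + 2 * n) (fun _ => (K : ℂ))
      + ENNReal.ofReal (B ^ 2) * (n * ENNReal.ofReal Real.pi), ?_, fun s hs => ?_⟩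
  · exact ENNReal.add_lt_top.2 ⟨bergmanMass_const_lt_top (by linarith) _, by finiteness⟩
  · calc ENNReal.ofReal (B ^ 2 * hardyConst α n) * bergmanMass α (extremalFun s)
        = ENNReal.ofReal (B ^ 2)
            * (ENNReal.ofReal (hardyConst α n) * bergmanMass α (extremalFun s)) := by
          rw [ENNReal.ofReal_mul (sq_nonneg B), mul_assoc]
      _ ≤ ENNReal.ofReal (B ^ 2) * (bergmanMass (α + 2 * n) (extremalFun (s + n))
            + n * ENNReal.ofReal Real.pi) :=
          mul_le_mul_right (hardyConst_mul_bergmanMass_extremalFun_le hα hs.1 hs.2.le n) _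
      _ = bergmanMass (α + 2 * n) (fun z => B * extremalFun (s + n) z)
            + ENNReal.ofReal (B ^ 2) * (n * ENNReal.ofReal Real.pi) := by
          rw [mul_add, bergmanMass_const_mul, Complex.norm_of_nonneg hB]
      _ ≤ _ := by
          rw [← add_assoc]
          gcongr
          exact bergmanMass_le_add (hg.mul (differentiableOn_extremalFun s)).continuousOn
            (hK s hs)

theorem exists_mul_bergmanMass_le (hα : -1 < α) (hg : DifferentiableOn ℂ g disk) (hA : 0 < A)
    (hone : Tendsto (fun z => ‖(1 - z ^ 2) ^ n * g z‖) (𝓝[disk] 1) (𝓝 A))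
    (hneg : Tendsto (fun z => ‖(1 - z ^ 2) ^ n * g z‖) (𝓝[disk] (-1)) (𝓝 A)) {κ : ℝ}
    (hκ : κ ∈ Set.Ioo 0 (A ^ 2 * hardyConst α n)) :
    ∃ φ, MemBergman α φ ∧ bergmanMass α φ ≠ 0 ∧
      ENNReal.ofReal κ * bergmanMass α φ ≤ bergmanMass (α + 2 * n) (fun z => g z * φ z) := by
  have hcont : Continuous fun B : ℝ => B ^ 2 * hardyConst α n := by fun_prop
  have hnear : ∀ᶠ B in 𝓝[<] A, κ < B ^ 2 * hardyConst α n :=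
    (hcont.continuousAt.eventually_const_lt hκ.2).filter_mono nhdsWithin_le_nhds
  obtain ⟨B, hκB, hB0, hBA⟩ := (hnear.and (Ioo_mem_nhdsLT hA)).exists
  obtain ⟨M, hM, hlower⟩ := exists_forall_mul_bergmanMass_extremalFun_le hα hg hB0.le
    (hone.eventually_const_le hBA) (hneg.eventually_const_le hBA)
  set ε := B ^ 2 * hardyConst α n - κ
  have hε : ENNReal.ofReal ε ≠ 0 := (ENNReal.ofReal_pos.2 (sub_pos.2 hκB)).ne'
  obtain ⟨s, hs, hlarge⟩ :=
    exists_lt_bergmanMass_extremalFun hα (ENNReal.div_lt_top hM.ne hε)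
  have hMε : M ≤ ENNReal.ofReal ε * bergmanMass α (extremalFun s) := by
    rw [mul_comm]
    exact (ENNReal.div_le_iff hε ENNReal.ofReal_ne_top).1 hlarge.le
  refine ⟨extremalFun s, memBergman_iff_bergmanMass_lt_top.2
    ⟨differentiableOn_extremalFun s, bergmanMass_extremalFun_lt_top hα hs.1 hs.2⟩,
    hlarge.ne_bot, ENNReal.le_of_add_le_add_right hM.ne ?_⟩
  calc ENNReal.ofReal κ * bergmanMass α (extremalFun s) + M
      ≤ ENNReal.ofReal κ * bergmanMass α (extremalFun s)
          + ENNReal.ofReal ε * bergmanMass α (extremalFun s) := by gcongr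
    _ = ENNReal.ofReal (B ^ 2 * hardyConst α n) * bergmanMass α (extremalFun s) := by
        rw [← add_mul, ← ENNReal.ofReal_add hκ.1.le (sub_pos.2 hκB).le, add_sub_cancel]
    _ ≤ _ := hlower s hs

theorem isMultiplier_and_multiplierNorm_eq (hα : -1 < α) (hg : DifferentiableOn ℂ g disk)
    (hA : 0 < A) (hle : ∀ z ∈ disk, ‖(1 - z ^ 2) ^ n * g z‖ ≤ A)
    (hone : Tendsto (fun z => ‖(1 - z ^ 2) ^ n * g z‖) (𝓝[disk] 1) (𝓝 A))
    (hneg : Tendsto (fun z => ‖(1 - z ^ 2) ^ n * g z‖) (𝓝[disk] (-1)) (𝓝 A)) :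
    IsMultiplier α (α + 2 * n) g ∧ multiplierNorm α (α + 2 * n) g
      = √(A ^ 2 * hardyConst α n * ((α + 2 * n + 1) / (α + 1))) := by
  have hβ : -1 < α + 2 * n := by have := n.cast_nonneg (α := ℝ); linarith
  have hC : 0 < A ^ 2 * hardyConst α n := mul_pos (pow_pos hA 2) (hardyConst_pos hα n)
  have hupper (φ : ℂ → ℂ) (hφ : DifferentiableOn ℂ φ disk) :=
    bergmanMass_mul_le_of_norm_le hα hle hφ
  exact ⟨isMultiplier_of_bergmanMass_mul_le hα hβ hg hC.le hupper,
    multiplierNorm_eq_sqrt hα hβ hg hC hupper fun κ hκ =>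
      exists_mul_bergmanMass_le hα hg hA hone hneg hκ⟩

theorem isMultiplier_and_multiplierNorm_eq_of_eq_div (hα : -1 < α) (hA : 0 < A) {h : ℂ → ℂ}
    (hh : Differentiable ℂ h) (hg : ∀ z ∈ disk, g z = h z / (1 - z ^ 2) ^ n)
    (hle : ∀ z ∈ disk, ‖h z‖ ≤ A) (hone : ‖h 1‖ = A) (hneg : ‖h (-1)‖ = A) :
    IsMultiplier α (α + 2 * n) g ∧ multiplierNorm α (α + 2 * n) g
      = √(A ^ 2 * hardyConst α n * ((α + 2 * n + 1) / (α + 1))) := by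
  have hmul (z : ℂ) (hz : z ∈ disk) : (1 - z ^ 2) ^ n * g z = h z := by
    rw [hg z hz, mul_div_cancel₀ _ (pow_ne_zero n (one_sub_sq_ne_zero hz))]
  have htendsto {ζ : ℂ} (hζ : ‖h ζ‖ = A) :
      Tendsto (fun z => ‖(1 - z ^ 2) ^ n * g z‖) (𝓝[disk] ζ) (𝓝 A) := by
    have hlim := (hh.continuous.norm.tendsto ζ).mono_left (nhdsWithin_le_nhds (s := disk))
    rw [hζ] at hlim
    refine hlim.congr' ?_
    filter_upwards [self_mem_nhdsWithin] with z hz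
    rw [hmul z hz]
  refine isMultiplier_and_multiplierNorm_eq hα ?_ hA (fun z hz => (hmul z hz).symm ▸ hle z hz)
    (htendsto hone) (htendsto hneg)
  refine DifferentiableOn.congr (fun z hz => ?_) hg
  exact (hh z).differentiableWithinAt.div (by fun_prop)
    (pow_ne_zero n (one_sub_sq_ne_zero hz))

end BoundaryValues

section KoebeFunction

theorem one_sub_mul_mem_slitPlane {z w : ℂ} (hz : z ∈ disk) (hw : w ∈ disk) :
    1 - z * w ∈ Complex.slitPlane := by
  rw [mem_ball_zero_iff] at hz hw
  have hlt : ‖-(z * w)‖ < 1 := by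
    rw [norm_neg, norm_mul]
    exact mul_lt_one_of_nonneg_of_lt_one_left (norm_nonneg z) hz hw.le
  simpa [sub_eq_add_neg] using Complex.mem_slitPlane_of_norm_lt_one hlt

theorem one_sub_mul_ne_zero {z w : ℂ} (hz : z ∈ disk) (hw : w ∈ disk) : 1 - z * w ≠ 0 :=
  Complex.slitPlane_ne_zero (one_sub_mul_mem_slitPlane hz hw)

theorem disk_mem_nhds {z : ℂ} (hz : z ∈ disk) : disk ∈ 𝓝 z := Metric.isOpen_ball.mem_nhds hz

theorem grunskyLog_koebe {z w : ℂ} (hz : z ∈ disk) (hw : w ∈ disk) :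
    grunskyLog koebe z w = Complex.log (1 - z * w) := by
  have hex : ∃ F, IsGrunskyLog koebe F := ⟨_, isGrunskyLog_koebe⟩
  have hlog : IsGrunskyLog koebe (grunskyLog koebe) := by
    rw [grunskyLog, dif_pos hex]
    exact hex.choose_spec
  exact hlog.unique isGrunskyLog_koebe hz hw

theorem hasDerivAt_log_one_sub_mul {z ζ : ℂ} (hz : z ∈ disk) (hζ : ζ ∈ disk) :
    HasDerivAt (fun ω => Complex.log (1 - ζ * ω)) (-ζ * (-ζ * z + 1)⁻¹) z := by
  have hsub : HasDerivAt (fun ω : ℂ => 1 - ζ * ω) (-ζ) z := by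
    simpa using ((hasDerivAt_id z).const_mul ζ).const_sub 1
  refine (hsub.clog (one_sub_mul_mem_slitPlane hζ hz)).congr_deriv ?_
  rw [div_eq_mul_inv, neg_mul ζ z, neg_add_eq_sub]

theorem iteratedDeriv_grunskyLog_koebe {z ζ : ℂ} (hz : z ∈ disk) (hζ : ζ ∈ disk) (q : ℕ) :
    iteratedDeriv (q + 1) (fun ω => grunskyLog koebe ζ ω) z
      = -(q.factorial : ℂ) * (ζ ^ (q + 1) / (1 - ζ * z) ^ (q + 1)) := by
  have hderiv : deriv (fun ω => grunskyLog koebe ζ ω) =ᶠ[𝓝 z] fun ω => -ζ * (-ζ * ω + 1)⁻¹ := by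
    filter_upwards [eventually_mem_nhds_iff.2 (disk_mem_nhds hz)] with ω hω
    have hlog : (fun ω => grunskyLog koebe ζ ω) =ᶠ[𝓝 ω] fun ω => Complex.log (1 - ζ * ω) := by
      filter_upwards [hω] with ω' hω' using grunskyLog_koebe hζ hω'
    rw [hlog.deriv_eq, (hasDerivAt_log_one_sub_mul (mem_of_mem_nhds hω) hζ).deriv]
  calc iteratedDeriv (q + 1) (fun ω => grunskyLog koebe ζ ω) z
      = -ζ * ((-1) ^ q * q.factorial * (-ζ) ^ q * (-ζ * z + 1) ^ (-1 - q : ℤ)) := by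
        rw [iteratedDeriv_succ', hderiv.iteratedDeriv_eq, iteratedDeriv_const_mul_field,
          iteratedDeriv_eq_iterate, iter_deriv_inv_linear]
    _ = -ζ * (q.factorial * ζ ^ q * ((1 - ζ * z) ^ (q + 1))⁻¹) := by
        rw [mul_right_comm ((-1) ^ q), ← mul_pow, neg_one_mul, neg_neg, mul_comm (ζ ^ q),
          neg_mul ζ z, neg_add_eq_sub, ← neg_add', add_comm 1, zpow_neg]
        norm_cast
    _ = _ := by rw [div_eq_mul_inv]; ring

/-- The numerator of the `(r + 1)`-st derivative of `z ^ q / (1 - z * w) ^ q` in `z` over the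
denominator `(1 - z * w) ^ (q + (r + 1))`, up to the factor `(r + 1)!`: it is the coefficient of
`u ^ (r + 1)` in `(z + u / (1 - u * w)) ^ q`, to which `ζ ^ q / (1 - ζ * w) ^ q` reduces, up to the
factor `(1 - z * w) ^ q`, under the substitution `ζ = z + (1 - z * w) * u`. -/
noncomputable def koebeNumerator (r q : ℕ) (z w : ℂ) : ℂ :=
  ∑ x ∈ antidiagonal (r + 1), r.choose x.1 * q.choose x.2 * z ^ (q - x.2) * w ^ x.1

theorem succ_mul_choose_succ (n k : ℕ) : (k + 1 : ℂ) * n.choose (k + 1) = n.choose k * (n - k) := by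
  rcases lt_or_ge n k with h | h
  · simp [Nat.choose_eq_zero_of_lt h, Nat.choose_eq_zero_of_lt (h.trans k.lt_succ_self)]
  · have := Nat.choose_succ_right_eq n k
    rw [mul_comm, ← Nat.cast_sub h]
    exact_mod_cast this

theorem hasDerivAt_pow_div_one_sub_mul_pow (k N : ℕ) {z w : ℂ} (h0 : 1 - z * w ≠ 0) :
    HasDerivAt (fun ζ => ζ ^ k / (1 - ζ * w) ^ N)
      ((k * z ^ (k - 1) + (N - k) * z ^ k * w) / (1 - z * w) ^ (N + 1)) z := by
  have hsub : HasDerivAt (fun ζ : ℂ => 1 - ζ * w) (-w) z := by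
    simpa using ((hasDerivAt_id z).mul_const w).const_sub 1
  have hpow : (k : ℂ) * z ^ (k - 1) * z = k * z ^ k := by
    rcases k with _ | k <;> simp [pow_succ, mul_assoc]
  have hderiv := (hasDerivAt_pow k z).fun_div (hsub.fun_pow N) (pow_ne_zero N h0)
  refine hderiv.congr_deriv ?_
  rw [div_eq_div_iff (pow_ne_zero _ (pow_ne_zero _ h0)) (pow_ne_zero _ h0)]
  rcases N with _ | N
  · simp only [Nat.cast_zero, pow_zero]
    linear_combination (-w) * hpow
  · simp only [Nat.add_sub_cancel]
    push_cast
    linear_combination (-w * (1 - z * w) ^ (2 * N + 2)) * hpow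

theorem succ_mul_koebeNumerator_succ (r q : ℕ) (z w : ℂ) :
    (r + 2) * koebeNumerator (r + 1) q z w
      = ∑ x ∈ antidiagonal (r + 1), r.choose x.1 * w ^ x.1 *
          ((x.2 + 1) * q.choose (x.2 + 1) * z ^ (q - (x.2 + 1))
            + (r + 1 + x.2) * q.choose x.2 * z ^ (q - x.2) * w) := by
  let T (x : ℕ × ℕ) : ℂ := x.2 * (r.choose x.1 * q.choose x.2 * z ^ (q - x.2) * w ^ x.1)
  have hshift : ∑ x ∈ antidiagonal (r + 1), T (x.1, x.2 + 1)
      = T (0, r + 2) + ∑ x ∈ antidiagonal (r + 1), T (x.1 + 1, x.2) := by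
    rw [← Finset.Nat.sum_antidiagonal_succ, Finset.Nat.sum_antidiagonal_succ' (n := r + 1)]
    simp [T]
  have hchoose {x : ℕ × ℕ} (hx : x ∈ antidiagonal (r + 1)) :
      (r + 2 : ℂ) * (r + 1).choose (x.1 + 1)
        = x.2 * r.choose (x.1 + 1) + (r + 1 + x.2) * r.choose x.1 := by
    have hsum : (x.1 : ℂ) + x.2 = r + 1 := mod_cast mem_antidiagonal.1 hx
    rw [Nat.choose_succ_succ', Nat.cast_add]
    linear_combination succ_mul_choose_succ r x.1 - (r.choose (x.1 + 1) + r.choose x.1) * hsum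
  calc (r + 2) * koebeNumerator (r + 1) q z w
      = T (0, r + 2) + ∑ x ∈ antidiagonal (r + 1), (r + 2) * ((r + 1).choose (x.1 + 1)
          * q.choose x.2 * z ^ (q - x.2) * w ^ (x.1 + 1)) := by
        rw [koebeNumerator, Finset.Nat.sum_antidiagonal_succ, mul_add, Finset.mul_sum]
        simp [T]
    _ = ∑ x ∈ antidiagonal (r + 1), (T (x.1, x.2 + 1)
          + (r + 1 + x.2) * (r.choose x.1 * q.choose x.2 * z ^ (q - x.2) * w ^ (x.1 + 1))) := by
        rw [Finset.sum_add_distrib, hshift, add_assoc, ← Finset.sum_add_distrib]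
        congr 1
        refine Finset.sum_congr rfl fun x hx => ?_
        linear_combination (q.choose x.2 * z ^ (q - x.2) * w ^ (x.1 + 1)) * hchoose hx
    _ = _ := Finset.sum_congr rfl fun x _ => by
        simp only [T]
        push_cast
        ring

theorem hasDerivAt_koebeNumerator_div (r q : ℕ) {z w : ℂ} (h0 : 1 - z * w ≠ 0) :
    HasDerivAt (fun ζ => koebeNumerator r q ζ w / (1 - ζ * w) ^ (q + (r + 1)))
      ((r + 2) * koebeNumerator (r + 1) q z w / (1 - z * w) ^ (q + (r + 2))) z := by
  have hterm (x : ℕ × ℕ) :=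
    (hasDerivAt_pow_div_one_sub_mul_pow (q - x.2) (q + (r + 1)) h0).const_mul
      (r.choose x.1 * q.choose x.2 * w ^ x.1 : ℂ)
  have hsum := HasDerivAt.fun_sum fun x (_ : x ∈ antidiagonal (r + 1)) => hterm x
  have hfun (ζ : ℂ) : koebeNumerator r q ζ w / (1 - ζ * w) ^ (q + (r + 1))
      = ∑ x ∈ antidiagonal (r + 1), (r.choose x.1 * q.choose x.2 * w ^ x.1 : ℂ)
          * (ζ ^ (q - x.2) / (1 - ζ * w) ^ (q + (r + 1))) := by
    rw [koebeNumerator, Finset.sum_div]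
    exact Finset.sum_congr rfl fun x _ => by ring
  simp only [hfun]
  refine hsum.congr_deriv ?_
  rw [succ_mul_koebeNumerator_succ, Finset.sum_div]
  refine Finset.sum_congr rfl fun x _ => ?_
  have hchoose : (q.choose x.2 : ℂ) * (q - x.2 : ℕ) = q.choose x.2 * (q - x.2) := by
    rcases lt_or_ge q x.2 with h | h
    · simp [Nat.choose_eq_zero_of_lt h]
    · rw [Nat.cast_sub h]
  rw [succ_mul_choose_succ, ← Nat.sub_sub, ← mul_div_assoc]
  congr 1
  push_cast
  linear_combination (r.choose x.1 * w ^ x.1 * (z ^ (q - x.2 - 1) - z ^ (q - x.2) * w)) * hchoose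

theorem iteratedDeriv_pow_div_one_sub_mul_pow {z w : ℂ} (hz : z ∈ disk) (hw : w ∈ disk)
    (r q : ℕ) :
    iteratedDeriv (r + 1) (fun ζ => ζ ^ q / (1 - ζ * w) ^ q) z
      = (r + 1).factorial * (koebeNumerator r q z w / (1 - z * w) ^ (q + (r + 1))) := by
  induction r generalizing z with
  | zero =>
    rw [iteratedDeriv_one,
      (hasDerivAt_pow_div_one_sub_mul_pow q q (one_sub_mul_ne_zero hz hw)).deriv]
    simp [koebeNumerator, Finset.Nat.sum_antidiagonal_succ]
  | succ r ih =>
    have hderiv : iteratedDeriv (r + 1) (fun ζ => ζ ^ q / (1 - ζ * w) ^ q) =ᶠ[𝓝 z] fun ζ =>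
        (r + 1).factorial * (koebeNumerator r q ζ w / (1 - ζ * w) ^ (q + (r + 1))) := by
      filter_upwards [disk_mem_nhds hz] with ζ hζ using ih hζ
    rw [iteratedDeriv_succ, hderiv.deriv_eq, ((hasDerivAt_koebeNumerator_div r q
      (one_sub_mul_ne_zero hz hw)).const_mul _).deriv, Nat.factorial_succ (r + 1)]
    push_cast
    ring

theorem higherSchwarzian_koebe {z : ℂ} (hz : z ∈ disk) (p q : ℕ) :
    higherSchwarzian koebe (p + 1) (q + 1) z
      = -(q.factorial * (p + 1).factorial) * koebeNumerator p (q + 1) z z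
          / (1 - z ^ 2) ^ (p + 1 + (q + 1)) := by
  have hinner : (fun ζ => iteratedDeriv (q + 1) (fun ω => grunskyLog koebe ζ ω) z) =ᶠ[𝓝 z]
      fun ζ => -(q.factorial : ℂ) * (ζ ^ (q + 1) / (1 - ζ * z) ^ (q + 1)) := by
    filter_upwards [disk_mem_nhds hz] with ζ hζ using iteratedDeriv_grunskyLog_koebe hz hζ q
  rw [higherSchwarzian, hinner.iteratedDeriv_eq, iteratedDeriv_const_mul_field,
    iteratedDeriv_pow_div_one_sub_mul_pow hz hz]
  ring

theorem koebeNumerator_one_one (r q : ℕ) :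
    koebeNumerator r q 1 1 = ((r + q).choose (r + 1) : ℂ) := by
  simp [koebeNumerator, Nat.add_choose_eq]

theorem norm_koebeNumerator_le (r q : ℕ) {z w : ℂ} (hz : ‖z‖ ≤ 1) (hw : ‖w‖ ≤ 1) :
    ‖koebeNumerator r q z w‖ ≤ (r + q).choose (r + 1) := by
  rw [Nat.add_choose_eq, Nat.cast_sum]
  refine norm_sum_le_of_le _ fun x _ => ?_
  rw [mul_assoc, norm_mul, norm_mul, norm_mul, norm_pow, norm_pow, Complex.norm_natCast,
    Complex.norm_natCast, Nat.cast_mul]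
  exact mul_le_of_le_one_right (by positivity)
    (mul_le_one₀ (pow_le_one₀ (norm_nonneg z) hz) (by positivity) (pow_le_one₀ (norm_nonneg w) hw))

theorem koebeNumerator_neg (r q : ℕ) (z w : ℂ) :
    koebeNumerator r q (-z) (-w) = (-1) ^ (r + q + 1) * koebeNumerator r q z w := by
  rw [koebeNumerator, koebeNumerator, Finset.mul_sum]
  refine Finset.sum_congr rfl fun x hx => ?_
  rcases lt_or_ge q x.2 with h | h
  · simp [Nat.choose_eq_zero_of_lt h]
  · have hsum := mem_antidiagonal.1 hx
    have hexp : r + q + 1 = q - x.2 + x.1 + (x.2 + x.2) := by omega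
    rw [neg_pow z, neg_pow w, hexp, pow_add, pow_add, (Even.add_self x.2).neg_one_pow]
    ring

theorem norm_koebeNumerator_neg_one (r q : ℕ) :
    ‖koebeNumerator r q (-1) (-1)‖ = (r + q).choose (r + 1) := by
  rw [koebeNumerator_neg, koebeNumerator_one_one]
  simp

end KoebeFunction

section Constants

variable {α : ℝ}

theorem gamma_mul_sq_gamma_eq_hardyConst (hα : -1 < α) (n : ℕ) :
    Real.Gamma (α + 2 + 2 * n) * Real.Gamma (α / 2 + 1) ^ 2
      = 4 ^ n * hardyConst α n * ((α + 2 * n + 1) / (α + 1))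
          * (Real.Gamma (α + 2) * Real.Gamma (α / 2 + 1 + n) ^ 2) := by
  have hα1 : α + 1 ≠ 0 := by linarith
  induction n with
  | zero => simp [hardyConst, hα1]
  | succ n ih =>
    have : (0 : ℝ) ≤ n := n.cast_nonneg
    have h2 : α + 2 * n + 2 ≠ 0 := by linarith
    have h1 : α + 2 * n + 1 ≠ 0 := by linarith
    have hnum : Real.Gamma (α + 2 + 2 * (n + 1 : ℕ))
        = (α + 2 * n + 3) * (α + 2 * n + 2) * Real.Gamma (α + 2 + 2 * n) := by
      rw [show α + 2 + 2 * ((n + 1 : ℕ) : ℝ) = α + 2 + 2 * n + 1 + 1 by push_cast; ring,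
        Real.Gamma_add_one (by linarith), Real.Gamma_add_one (by linarith)]
      ring
    have hden : Real.Gamma (α / 2 + 1 + (n + 1 : ℕ))
        = (α + 2 * n + 2) / 2 * Real.Gamma (α / 2 + 1 + n) := by
      rw [Nat.cast_succ, ← add_assoc, Real.Gamma_add_one (by linarith)]
      ring
    rw [hnum, hden, mul_assoc, ih, hardyConst_succ]
    push_cast
    field_simp
    ring

theorem koebeConst_eq (hα : -1 < α) (p q : ℕ) :
    koebeConst α p q = ((p + q - 1).factorial : ℝ) ^ 2 * hardyConst α (p + q)
      * ((α + 2 * (p + q : ℕ) + 1) / (α + 1)) := by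
  have : (0 : ℝ) ≤ (p + q : ℕ) := Nat.cast_nonneg _
  have hGamma : Real.Gamma (α + 2) ≠ 0 := (Real.Gamma_pos_of_pos (by linarith)).ne'
  have hGamma_add : Real.Gamma (α / 2 + 1 + (p + q : ℕ)) ≠ 0 :=
    (Real.Gamma_pos_of_pos (by linarith)).ne'
  have hgamma := gamma_mul_sq_gamma_eq_hardyConst hα (p + q)
  have hpow : (2 : ℝ) ^ (2 * p + 2 * q) = 4 ^ (p + q) := by
    rw [← mul_add, pow_mul]; norm_num
  rw [koebeConst, hpow, show α + 2 + 2 * (p : ℝ) + 2 * q = α + 2 + 2 * (p + q : ℕ) by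
    push_cast; ring, add_assoc (α / 2 + 1), ← Nat.cast_add]
  calc _ = ((p + q - 1).factorial : ℝ) ^ 2 * (Real.Gamma (α + 2 + 2 * (p + q : ℕ))
        * Real.Gamma (α / 2 + 1) ^ 2) / (4 ^ (p + q) * (Real.Gamma (α + 2)
        * Real.Gamma (α / 2 + 1 + (p + q : ℕ)) ^ 2)) := by ring
    _ = _ := by
      rw [hgamma, div_eq_iff (by positivity)]
      ring

end Constants

section KoebeSchwarzian

theorem one_sub_ne_zero_of_mem_disk {z : ℂ} (hz : z ∈ disk) : 1 - z ≠ 0 := by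
  have h := one_sub_sq_ne_zero hz
  rw [show 1 - z ^ 2 = (1 - z) * (1 + z) by ring] at h
  exact left_ne_zero_of_mul h

theorem deriv_koebe {z : ℂ} (hz : z ∈ disk) : deriv koebe z = (1 + z) / (1 - z) ^ 3 := by
  have h0 := one_sub_ne_zero_of_mem_disk hz
  have hderiv := (hasDerivAt_id' z).fun_div (((hasDerivAt_id' z).const_sub 1).fun_pow 2)
    (pow_ne_zero 2 h0)
  refine (hderiv.congr_deriv ?_).deriv
  field_simp
  push_cast
  ring

theorem deriv_deriv_koebe {z : ℂ} (hz : z ∈ disk) :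
    deriv (deriv koebe) z = (2 * z + 4) / (1 - z) ^ 4 := by
  have h0 := one_sub_ne_zero_of_mem_disk hz
  have hfirst : deriv koebe =ᶠ[𝓝 z] fun ζ => (1 + ζ) / (1 - ζ) ^ 3 := by
    filter_upwards [disk_mem_nhds hz] with ζ hζ using deriv_koebe hζ
  have hderiv := ((hasDerivAt_id' z).const_add 1).fun_div
    (((hasDerivAt_id' z).const_sub 1).fun_pow 3) (pow_ne_zero 3 h0)
  rw [hfirst.deriv_eq]
  refine (hderiv.congr_deriv ?_).deriv
  field_simp
  push_cast
  ring

theorem deriv_deriv_koebe_div_deriv {z : ℂ} (hz : z ∈ disk) :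
    deriv (deriv koebe) z / deriv koebe z = (2 * z + 4) / (1 - z ^ 2) := by
  have h0 := one_sub_sq_ne_zero hz
  rw [show 1 - z ^ 2 = (1 - z) * (1 + z) by ring] at h0 ⊢
  have h1 := left_ne_zero_of_mul h0
  have h2 := right_ne_zero_of_mul h0
  rw [deriv_koebe hz, deriv_deriv_koebe hz]
  field_simp

theorem schwarzian_koebe {z : ℂ} (hz : z ∈ disk) :
    schwarzian koebe z = -6 / (1 - z ^ 2) ^ 2 := by
  have h0 := one_sub_sq_ne_zero hz
  have hratio : (fun ζ => deriv (deriv koebe) ζ / deriv koebe ζ) =ᶠ[𝓝 z]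
      fun ζ => (2 * ζ + 4) / (1 - ζ ^ 2) := by
    filter_upwards [disk_mem_nhds hz] with ζ hζ using deriv_deriv_koebe_div_deriv hζ
  have hderiv := (((hasDerivAt_id' z).const_mul 2).add_const 4).fun_div
    ((hasDerivAt_pow 2 z).const_sub 1) h0
  rw [schwarzian, hratio.deriv_eq, deriv_deriv_koebe_div_deriv hz, hderiv.deriv]
  field_simp
  push_cast
  ring

end KoebeSchwarzian

section KoebeMultipliers

variable {α : ℝ}

theorem isMultiplier_and_multiplierNorm_higherSchwarzian_koebe (hα : -1 < α) (p q : ℕ) :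
    IsMultiplier α (α + 2 * (p + 1 + (q + 1) : ℕ)) (higherSchwarzian koebe (p + 1) (q + 1)) ∧
      multiplierNorm α (α + 2 * (p + 1 + (q + 1) : ℕ)) (higherSchwarzian koebe (p + 1) (q + 1))
        = √(koebeConst α (p + 1) (q + 1)) := by
  have hfact : (q.factorial * (p + 1).factorial : ℝ) * (p + (q + 1)).choose (p + 1)
      = (p + 1 + (q + 1) - 1).factorial := by
    have h := Nat.add_choose_mul_factorial_mul_factorial q (p + 1)
    rw [show p + (q + 1) = q + (p + 1) by omega, show p + 1 + (q + 1) - 1 = q + (p + 1) by omega,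
      ← h]
    push_cast
    ring
  have hnorm (z : ℂ) :
      ‖-(q.factorial * (p + 1).factorial : ℂ) * koebeNumerator p (q + 1) z z‖
        = q.factorial * (p + 1).factorial * ‖koebeNumerator p (q + 1) z z‖ := by
    simp only [norm_mul, norm_neg, Complex.norm_natCast]
  rw [koebeConst_eq hα]
  refine isMultiplier_and_multiplierNorm_eq_of_eq_div hα (by positivity)
    (h := fun z => -(q.factorial * (p + 1).factorial : ℂ) * koebeNumerator p (q + 1) z z)
    (by unfold koebeNumerator; fun_prop) (fun z hz => higherSchwarzian_koebe hz p q) ?_ ?_ ?_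
  · intro z hz
    have hz1 := (mem_ball_zero_iff.1 hz).le
    rw [hnorm, ← hfact]
    gcongr
    exact norm_koebeNumerator_le p (q + 1) hz1 hz1
  · rw [hnorm, ← hfact, koebeNumerator_one_one, Complex.norm_natCast]
  · rw [hnorm, ← hfact, norm_koebeNumerator_neg_one]

theorem isMultiplier_and_multiplierNorm_schwarzian_koebe (hα : -1 < α) :
    IsMultiplier α (α + 2 * (2 : ℕ)) (schwarzian koebe) ∧
      multiplierNorm α (α + 2 * (2 : ℕ)) (schwarzian koebe)
        = √(36 * (α + 3) * (α + 5) / ((α + 2) * (α + 4))) := by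
  have hconst : 6 ^ 2 * hardyConst α 2 * ((α + 2 * (2 : ℕ) + 1) / (α + 1))
      = 36 * (α + 3) * (α + 5) / ((α + 2) * (α + 4)) := by
    have h1 : α + 1 ≠ 0 := by linarith
    rw [hardyConst_succ, hardyConst_succ, hardyConst, Finset.prod_range_zero]
    push_cast
    field_simp
    ring
  rw [← hconst]
  exact isMultiplier_and_multiplierNorm_eq_of_eq_div hα (by norm_num) (h := fun _ => -6)
    (differentiable_const _) (fun z hz => schwarzian_koebe hz) (by simp) (by simp) (by simp)

end KoebeMultipliers

theorem theorem2p1 (α : ℝ) (hα : -1 < α) :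
    (∀ p q : ℕ, 1 ≤ p → 1 ≤ q →
      IsMultiplier α (α + 2 * p + 2 * q) (higherSchwarzian koebe p q) ∧
      multiplierNorm α (α + 2 * p + 2 * q) (higherSchwarzian koebe p q)
        = √(koebeConst α p q)) ∧
    (IsMultiplier α (α + 4) (schwarzian koebe) ∧
      multiplierNorm α (α + 4) (schwarzian koebe) ^ 2
        = 36 * (α + 3) * (α + 5) / ((α + 2) * (α + 4))) := by
  constructor
  · intro p q hp hq
    obtain ⟨p, rfl⟩ := Nat.exists_eq_add_of_le' hp
    obtain ⟨q, rfl⟩ := Nat.exists_eq_add_of_le' hq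
    rw [add_assoc, ← mul_add, ← Nat.cast_add]
    exact isMultiplier_and_multiplierNorm_higherSchwarzian_koebe hα p q
  · obtain ⟨hmult, hnorm⟩ := isMultiplier_and_multiplierNorm_schwarzian_koebe hα
    rw [show α + 2 * (2 : ℕ) = α + 4 by norm_num] at hmult hnorm
    have hnonneg : 0 ≤ 36 * (α + 3) * (α + 5) / ((α + 2) * (α + 4)) := by
      have h2 : 0 < α + 2 := by linarith
      rw [show α + 3 = α + 2 + 1 by ring, show α + 4 = α + 2 + 2 by ring,
        show α + 5 = α + 2 + 3 by ring]
      positivity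
    exact ⟨hmult, by rw [hnorm, Real.sq_sqrt hnonneg]⟩
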